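/- Let $k$ be an algebraically closed field; modules are finitely generated right modules. Let $\Gamma$ be a finite acyclic quiver with vertex set $\Gamma_0$, and let $\mathcal A=(A_j)_{j\in\Gamma_0}$ be a family of finite-dimensional basic $k$-algebras, each with a chosen presentation $A_j\cong k\Sigma_j/\Omega_j$ by a finite quiver $\Sigma_j$ and an admissible ideal $\Omega_j$. Let $I$ be a set of relations in $\Gamma$ (nonzero linear combinations of paths of length at least two with common start and common end) generating an admissible ideal of $k\Gamma$. The generalized path algebra $k(\Gamma,\mathcal A)$ is the space spanned by the $\mathcal A$-paths $a_1\beta_1a_2\cdots a_n\beta_na_{n+1}$, where $\beta_1\cdots\beta_n$ is a path of $\Gamma$, $a_t\in A_{s(\beta_t)}$ for $t\le n$ and $a_{n+1}\in A_{e(\beta_n)}$ (for $n=0$: elements of some $A_j$), modulo linearity in each entry $a_t$. Its product is $(a_1\beta_1\cdots\beta_na_{n+1})(b_1\gamma_1\cdots\gamma_mb_{m+1})=a_1\beta_1\cdots\beta_n(a_{n+1}b_1)\gamma_1\cdots\gamma_mb_{m+1}$ if the paths are composable, and $0$ otherwise. The generalized bound path algebra $\Lambda=k(\Gamma,\mathcal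 A,I)$ is the quotient of $k(\Gamma,\mathcal A)$ by the two-sided ideal generated by all elements $\sum_t\lambda_t\,\beta_{t1}\overline{\gamma_{t1}}\beta_{t2}\cdots\overline{\gamma_{t(m_t-1)}}\beta_{tm_t}$, where $\sum_t\lambda_t\beta_{t1}\cdots\beta_{tm_t}$ is a relation in $I$ and each $\gamma_{tr}$ is any path of $\Sigma_{e(\beta_{tr})}$, with image $\overline{\gamma_{tr}}$ in $A_{e(\beta_{tr})}$. For $i\in\Gamma_0$, an $A_i$-module $N$ is regarded as a module over $\prod_jA_j$ through the $i$-th factor, and its cone is the $\Lambda$-module $\mathcal C_i(N)=N\otimes_{\prod_jA_j}\Lambda$. Also, $N$ is regarded as a $\Lambda$-module concentrated at the vertex $i$, with all arrows acting as zero. For a $\Lambda$-module $L$ and $j\in\Gamma_0$, put $L_j=L\cdot 1_{A_j}$, an $A_j$-module, and $\operatorname{supp}L=\{j\in\Gamma_0: L_j\ne0\}$. Let $i\in\Gamma_0$, let $M$ be an $A_i$-module and let $g\colon P\to M$ be a projective cover of $M$ over $A_i$. Then there are a $\Lambda$-module $L$ and an exact sequence of $\Lambda$-modules $$0\to\mathcal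 C_i(\operatorname{Ker}g)\oplus L\to\mathcal C_i(P)\to M\to0$$ such that $\operatorname{supp}L\subseteq\{j\in\Gamma_0: j\ne i\text{ and there is a path from }i\text{ to }j\text{ in }\Gamma\}$. Moreover: 1. $L_j$ is a free $A_j$-module for every $j\in\Gamma_0$; 2. if no relation in $I$ starts at $i$, then $L$ is a projective $\Lambda$-module. -/

import Mathlib

open scoped TensorProduct

universe u v e w x y

noncomputable section

namespace GBP

/-! ### Generalized paths

Throughout, modules are *right* modules: a right module over a ring `R` is a `Module Rᵐᵒᵖ M`, and
`MulOpposite.op r • m` is `m · r`. Paths are composed from left to right. -/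

/-- An `A`-path `a₁ β₁ a₂ … aₙ βₙ aₙ₊₁`: a path `β₁ … βₙ` of the quiver `V` together with an element
of the algebra sitting at each vertex that the path visits. -/
inductive APath {V : Type v} [Quiver.{e} V] (A : V → Type w) : V → V → Type (max v e w)
  | nil {i : V} (a : A i) : APath A i i
  | cons {i j l : V} (p : APath A i j) (β : j ⟶ l) (a : A l) : APath A i l

namespace APath

section

variable {k : Type u} [Field k] {V : Type v} [Quiver.{e} V] {A : V → Type w} [∀ i, Ring (A i)]
  [∀ i, Algebra k (A i)]

/-- Multiply the last entry of an `A`-path by `b` on the right. -/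
def rmul {i : V} : ∀ {j : V}, APath A i j → A j → APath A i j
  | _, nil a, b => nil (a * b)
  | _, cons p β a, b => cons p β (a * b)

/-- The product of composable `A`-paths:
`(a₁ β₁ … βₙ aₙ₊₁)(b₁ γ₁ … γₘ bₘ₊₁) = a₁ β₁ … βₙ (aₙ₊₁ b₁) γ₁ … γₘ bₘ₊₁`. -/
def comp {i j : V} (p : APath A i j) : ∀ {l : V}, APath A j l → APath A i l
  | _, nil b => rmul p b
  | _, cons q β b => cons (comp p q) β b

/-- `IsSum p p₁ p₂`: the three `A`-paths agree except in one entry, and there the entry of `p` is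
the sum of the entries of `p₁` and `p₂`. -/
inductive IsSum {i : V} : ∀ {j : V}, APath A i j → APath A i j → APath A i j → Prop
  | nil (a b : A i) : IsSum (nil (a + b)) (nil a) (nil b)
  | last {j l : V} (p : APath A i j) (β : j ⟶ l) (a b : A l) :
      IsSum (cons p β (a + b)) (cons p β a) (cons p β b)
  | cons {j l : V} {p p₁ p₂ : APath A i j} (h : IsSum p p₁ p₂) (β : j ⟶ l) (a : A l) :
      IsSum (cons p β a) (cons p₁ β a) (cons p₂ β a)

/-- `IsSMul c p q`: the two `A`-paths agree except in one entry, and there the entry of `p` is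
`c` times the entry of `q`. -/
inductive IsSMul (c : k) {i : V} : ∀ {j : V}, APath A i j → APath A i j → Prop
  | nil (a : A i) : IsSMul c (nil (c • a)) (nil a)
  | last {j l : V} (p : APath A i j) (β : j ⟶ l) (a : A l) :
      IsSMul c (cons p β (c • a)) (cons p β a)
  | cons {j l : V} {p q : APath A i j} (h : IsSMul c p q) (β : j ⟶ l) (a : A l) :
      IsSMul c (cons p β a) (cons q β a)

/-- The element of `A i` carried by an `A`-path of length `0` at `i`; `0` on longer `A`-paths. -/
def entry {i : V} : APath A i i → A i
  | nil a => a
  | cons _ _ _ => 0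

/-- The `A`-path `1 β₁ 1 … βₙ 1` underlying a path `β₁ … βₙ` of the quiver. -/
def ofPath {i : V} : ∀ {j : V}, Quiver.Path i j → APath A i j
  | _, Quiver.Path.nil => nil 1
  | _, Quiver.Path.cons p β => cons (ofPath p) β 1

theorem comp_rmul {i j l : V} (p : APath A i j) (q : APath A j l) (b : A l) :
    comp p (rmul q b) = rmul (comp p q) b := by
  cases q with
  | nil a => cases p <;> simp [comp, rmul, mul_assoc]
  | cons q β a => simp [comp, rmul]

theorem comp_assoc {i j l m : V} (p : APath A i j) (q : APath A j l) (r : APath A l m) :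
    comp (comp p q) r = comp p (comp q r) := by
  induction r with
  | nil a => simp [comp, comp_rmul]
  | cons r β a ih => simp [comp, ih]

theorem comp_one {i j : V} (p : APath A i j) : comp p (nil 1) = p := by
  cases p <;> simp [comp, rmul]

theorem one_comp {i j : V} (p : APath A i j) : comp (nil 1) p = p := by
  induction p with
  | nil a => simp [comp, rmul]
  | cons p β a ih => simp [comp, ih]

theorem IsSum.rmul {i j : V} {p p₁ p₂ : APath A i j} (h : IsSum p p₁ p₂) (b : A j) :
    IsSum (p.rmul b) (p₁.rmul b) (p₂.rmul b) := by
  cases h with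
  | nil a c => simpa [APath.rmul, add_mul] using IsSum.nil (a * b) (c * b)
  | last p β a c => simpa [APath.rmul, add_mul] using IsSum.last p β (a * b) (c * b)
  | cons h β a => exact IsSum.cons h β (a * b)

theorem IsSum.comp_right {i j l : V} {p p₁ p₂ : APath A i j} (h : IsSum p p₁ p₂)
    (q : APath A j l) : IsSum (p.comp q) (p₁.comp q) (p₂.comp q) := by
  induction q with
  | nil b => exact h.rmul b
  | cons q β b ih => exact IsSum.cons ih β b

theorem isSum_rmul {i j : V} (p : APath A i j) (a b : A j) :
    IsSum (p.rmul (a + b)) (p.rmul a) (p.rmul b) := by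
  cases p with
  | nil c => simpa [APath.rmul, mul_add] using IsSum.nil (c * a) (c * b)
  | cons p β c => simpa [APath.rmul, mul_add] using IsSum.last p β (c * a) (c * b)

theorem IsSum.comp_left {i j l : V} (p : APath A i j) {q q₁ q₂ : APath A j l}
    (h : IsSum q q₁ q₂) : IsSum (p.comp q) (p.comp q₁) (p.comp q₂) := by
  induction h with
  | nil a b => exact isSum_rmul p a b
  | last q β a b => exact IsSum.last _ β a b
  | cons h β a ih => exact IsSum.cons ih β a

theorem IsSMul.rmul {c : k} {i j : V} {p q : APath A i j} (h : IsSMul c p q) (b : A j) :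
    IsSMul c (p.rmul b) (q.rmul b) := by
  cases h with
  | nil a => simpa [APath.rmul] using IsSMul.nil (c := c) (a * b)
  | last p β a => simpa [APath.rmul] using IsSMul.last (c := c) p β (a * b)
  | cons h β a => exact IsSMul.cons h β (a * b)

theorem IsSMul.comp_right {c : k} {i j l : V} {p p' : APath A i j} (h : IsSMul c p p')
    (q : APath A j l) : IsSMul c (p.comp q) (p'.comp q) := by
  induction q with
  | nil b => exact h.rmul b
  | cons q β b ih => exact IsSMul.cons ih β b

theorem isSMul_rmul (c : k) {i j : V} (p : APath A i j) (a : A j) :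
    IsSMul c (p.rmul (c • a)) (p.rmul a) := by
  cases p with
  | nil b => simpa [APath.rmul] using IsSMul.nil (c := c) (b * a)
  | cons p β b => simpa [APath.rmul] using IsSMul.last (c := c) p β (b * a)

theorem IsSMul.comp_left {c : k} {i j l : V} (p : APath A i j) {q q' : APath A j l}
    (h : IsSMul c q q') : IsSMul c (p.comp q) (p.comp q') := by
  induction h with
  | nil a => exact isSMul_rmul c p a
  | last q β a => exact IsSMul.last _ β a
  | cons h β a ih => exact IsSMul.cons ih β a

theorem entry_comp {i : V} (p q : APath A i i) : entry (p.comp q) = entry p * entry q := by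
  cases q with
  | nil b => cases p <;> simp [comp, rmul, entry]
  | cons q β b => simp [comp, entry]

theorem entry_comp_of_ne {i j : V} (h : j ≠ i) (p : APath A i j) (q : APath A j i) :
    entry (p.comp q) = 0 := by
  cases q with
  | nil b => exact absurd rfl h
  | cons q β b => simp [comp, entry]

theorem IsSum.entry {i : V} {p p₁ p₂ : APath A i i} (h : IsSum p p₁ p₂) :
    p.entry = p₁.entry + p₂.entry := by
  cases h <;> simp [APath.entry]

theorem IsSMul.entry {c : k} {i : V} {p q : APath A i i} (h : IsSMul c p q) :
    p.entry = c • q.entry := by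
  cases h <;> simp [APath.entry]

end

end APath

/-! ### The generalized path algebra -/

section Algebra

variable (k : Type u) [Field k] {V : Type v} [Quiver.{e} V] (A : V → Type w) [∀ i, Ring (A i)]
  [∀ i, Algebra k (A i)]

/-- The relations that make formal combinations of `A`-paths from `i` to `j` additive and
`k`-homogeneous in every entry. -/
def multilinearRel (i j : V) : Submodule k (APath A i j →₀ k) :=
  Submodule.span k
    ({y | ∃ p p₁ p₂ : APath A i j, APath.IsSum p p₁ p₂ ∧
        y = Finsupp.single p 1 - Finsupp.single p₁ 1 - Finsupp.single p₂ 1} ∪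
      {y | ∃ (c : k) (p q : APath A i j), APath.IsSMul c p q ∧
        y = Finsupp.single p 1 - c • Finsupp.single q 1})

/-- The space of formal combinations of `A`-paths from `i` to `j` modulo multilinearity. -/
def PathSpace (i j : V) : Type (max u v e w) :=
  (APath A i j →₀ k) ⧸ multilinearRel k A i j

instance (i j : V) : AddCommGroup (PathSpace k A i j) :=
  inferInstanceAs (AddCommGroup ((APath A i j →₀ k) ⧸ multilinearRel k A i j))

instance (i j : V) : Module k (PathSpace k A i j) :=
  inferInstanceAs (Module k ((APath A i j →₀ k) ⧸ multilinearRel k A i j))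

/-- The quotient map onto `PathSpace k A i j`. -/
def pathMk (i j : V) : (APath A i j →₀ k) →ₗ[k] PathSpace k A i j :=
  (multilinearRel k A i j).mkQ

variable {A}

/-- The class of an `A`-path. -/
def cls {i j : V} (p : APath A i j) : PathSpace k A i j :=
  pathMk k A i j (Finsupp.single p 1)

variable {k} in
theorem cls_isSum {i j : V} {p p₁ p₂ : APath A i j} (h : APath.IsSum p p₁ p₂) :
    cls k p = cls k p₁ + cls k p₂ := by
  have : pathMk k A i j (Finsupp.single p 1 - Finsupp.single p₁ 1 - Finsupp.single p₂ 1) = 0 :=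
    (Submodule.Quotient.mk_eq_zero _).2 (Submodule.subset_span (Or.inl ⟨p, p₁, p₂, h, rfl⟩))
  rw [map_sub, map_sub, sub_sub, sub_eq_zero] at this
  exact this

variable {k} in
theorem cls_isSMul {c : k} {i j : V} {p q : APath A i j} (h : APath.IsSMul c p q) :
    cls k p = c • cls k q := by
  have : pathMk k A i j (Finsupp.single p 1 - c • Finsupp.single q 1) = 0 :=
    (Submodule.Quotient.mk_eq_zero _).2 (Submodule.subset_span (Or.inr ⟨c, p, q, h, rfl⟩))
  rw [map_sub, map_smul, sub_eq_zero] at this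
  exact this

/-- The linear map out of `PathSpace k A i j` given by a multilinear function on `A`-paths. -/
def pathLift {X : Type x} [AddCommGroup X] [Module k X] {i j : V} (f : APath A i j → X)
    (hadd : ∀ p p₁ p₂, APath.IsSum p p₁ p₂ → f p = f p₁ + f p₂)
    (hsmul : ∀ (c : k) p q, APath.IsSMul c p q → f p = c • f q) : PathSpace k A i j →ₗ[k] X :=
  (multilinearRel k A i j).liftQ (Finsupp.linearCombination k f) <| by
    rw [multilinearRel, Submodule.span_le]
    rintro y (⟨p, p₁, p₂, h, rfl⟩ | ⟨c, p, q, h, rfl⟩)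
    · simp [hadd p p₁ p₂ h]
    · simp [hsmul c p q h]

@[simp]
theorem pathLift_cls {X : Type x} [AddCommGroup X] [Module k X] {i j : V} (f : APath A i j → X)
    (hadd : ∀ p p₁ p₂, APath.IsSum p p₁ p₂ → f p = f p₁ + f p₂)
    (hsmul : ∀ (c : k) p q, APath.IsSMul c p q → f p = c • f q) (p : APath A i j) :
    pathLift k f hadd hsmul (cls k p) = f p := by
  change Finsupp.linearCombination k f (Finsupp.single p 1) = f p
  simp

theorem pathSpace_induction {i j : V} {motive : PathSpace k A i j → Prop}
    (cls : ∀ p, motive (cls k p)) (zero : motive 0)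
    (add : ∀ f g, motive f → motive g → motive (f + g))
    (smul : ∀ (c : k) f, motive f → motive (c • f)) (f : PathSpace k A i j) : motive f := by
  obtain ⟨f, rfl⟩ := (multilinearRel k A i j).mkQ_surjective f
  change motive (pathMk k A i j f)
  induction f using Finsupp.induction_linear with
  | zero => rwa [map_zero]
  | add f g hf hg => rw [map_add]; exact add _ _ hf hg
  | single p c =>
    have := smul c _ (cls p)
    rwa [GBP.cls, ← map_smul, Finsupp.smul_single_one] at this

variable {k} in
theorem pathSpace_ext {X : Type x} [AddCommGroup X] [Module k X] {i j : V}
    {f g : PathSpace k A i j →ₗ[k] X} (h : ∀ p, f (cls k p) = g (cls k p)) : f = g := by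
  ext y
  induction y using pathSpace_induction with
  | cls p => exact h p
  | zero => simp
  | add y z hy hz => simp [hy, hz]
  | smul c y hy => simp [hy]

/-- The bilinear extension of the product of composable `A`-paths. -/
def compₗ {i j l : V} : PathSpace k A i j →ₗ[k] PathSpace k A j l →ₗ[k] PathSpace k A i l :=
  pathLift k
    (fun p => pathLift k (fun q => cls k (p.comp q))
      (fun _ _ _ h => cls_isSum (h.comp_left p)) (fun _ _ _ h => cls_isSMul (h.comp_left p)))
    (fun _ _ _ h => pathSpace_ext fun q => by simpa using cls_isSum (h.comp_right q))
    (fun _ _ _ h => pathSpace_ext fun q => by simpa using cls_isSMul (h.comp_right q))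

@[simp]
theorem compₗ_cls {i j l : V} (p : APath A i j) (q : APath A j l) :
    compₗ k (cls k p) (cls k q) = cls k (p.comp q) := by
  simp [compₗ]

theorem compₗ_assoc {i j l m : V} (f : PathSpace k A i j) (g : PathSpace k A j l)
    (h : PathSpace k A l m) : compₗ k (compₗ k f g) h = compₗ k f (compₗ k g h) := by
  induction f using pathSpace_induction with
  | zero => simp
  | add f f' hf hf' => simp [hf, hf']
  | smul c f hf => simp [hf]
  | cls p =>
    induction g using pathSpace_induction with
    | zero => simp
    | add g g' hg hg' => simp [hg, hg']
    | smul c g hg => simp [hg]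
    | cls q =>
      induction h using pathSpace_induction with
      | zero => simp
      | add h h' hh hh' => rw [map_add, map_add, map_add, hh, hh']
      | smul c h hh => rw [map_smul, map_smul, map_smul, hh]
      | cls r => simp [APath.comp_assoc]

theorem compₗ_one {i j : V} (f : PathSpace k A i j) : compₗ k f (cls k (APath.nil 1)) = f := by
  have : (compₗ k).flip (cls k (APath.nil (1 : A j))) = (LinearMap.id : PathSpace k A i j →ₗ[k] _) :=
    pathSpace_ext fun p => by simp [APath.comp_one]
  exact LinearMap.congr_fun this f

theorem one_compₗ {i j : V} (f : PathSpace k A i j) : compₗ k (cls k (APath.nil 1)) f = f := by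
  have : compₗ k (cls k (APath.nil (1 : A i))) = (LinearMap.id : PathSpace k A i j →ₗ[k] _) :=
    pathSpace_ext fun p => by simp [APath.one_comp]
  exact LinearMap.congr_fun this f

variable (A)

/-- The generalized path algebra `k(V, A)`. As `V` has finitely many vertices, the space spanned by
all `A`-paths modulo multilinearity is the direct sum of its parts `PathSpace k A i j`, and an element
is the matrix of its components; products of non-composable `A`-paths vanish, so that the
multiplication is matrix multiplication. -/
def GenPathAlgebra : Type (max u v e w) := ∀ i j : V, PathSpace k A i j

namespace GenPathAlgebra

instance : AddCommGroup (GenPathAlgebra k A) :=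
  inferInstanceAs (AddCommGroup (∀ i j : V, PathSpace k A i j))

instance : Module k (GenPathAlgebra k A) :=
  inferInstanceAs (Module k (∀ i j : V, PathSpace k A i j))

variable {A} in
open Classical in
/-- An element of `PathSpace k A i j` as an element of the generalized path algebra. -/
def single {i j : V} : PathSpace k A i j →ₗ[k] GenPathAlgebra k A :=
  (LinearMap.single k (fun i => ∀ j, PathSpace k A i j) i) ∘ₗ
    (LinearMap.single k (fun j => PathSpace k A i j) j)

variable {A}

theorem single_self {i j : V} (f : PathSpace k A i j) : single k f i j = f := by
  classical
  exact (congrFun (Pi.single_eq_same i _) j).trans (Pi.single_eq_same j f)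

theorem single_ne_left {i j i' : V} (f : PathSpace k A i j) (h : i' ≠ i) (j' : V) :
    single k f i' j' = 0 := by
  classical
  exact congrFun (Pi.single_eq_of_ne (M := fun i => ∀ j, PathSpace k A i j) h _) j'

theorem single_ne_right {i j j' : V} (f : PathSpace k A i j) (i' : V) (h : j' ≠ j) :
    single k f i' j' = 0 := by
  classical
  by_cases hi : i' = i
  · subst hi
    exact (congrFun (Pi.single_eq_same i' _) j').trans (Pi.single_eq_of_ne h f)
  · exact single_ne_left k f hi j'

@[simp] theorem add_apply (f g : GenPathAlgebra k A) (i j : V) : (f + g) i j = f i j + g i j := rfl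
@[simp] theorem zero_apply (i j : V) : (0 : GenPathAlgebra k A) i j = 0 := rfl
@[simp] theorem smul_apply (c : k) (f : GenPathAlgebra k A) (i j : V) :
    (c • f) i j = c • f i j := rfl

theorem sum_apply {ι : Type*} (s : Finset ι) (f : ι → GenPathAlgebra k A) (i j : V) :
    (∑ a ∈ s, f a) i j = ∑ a ∈ s, f a i j := by
  classical
  induction s using Finset.induction_on with
  | empty => simp
  | insert a s ha ih => simp [Finset.sum_insert ha, ih]

variable [Fintype V]

instance : Mul (GenPathAlgebra k A) where
  mul f g := fun i j => ∑ l, compₗ k (f i l) (g l j)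

theorem mul_apply (f g : GenPathAlgebra k A) (i j : V) :
    (f * g) i j = ∑ l, compₗ k (f i l) (g l j) := rfl

/-- The unit is the sum of the unit elements of the algebras `A i`. -/
instance : One (GenPathAlgebra k A) where
  one := ∑ i, single k (cls k (APath.nil (1 : A i)))

theorem one_apply_self (i : V) : (1 : GenPathAlgebra k A) i i = cls k (APath.nil 1) := by
  change (∑ l, single k (cls k (APath.nil (1 : A l)))) i i = _
  rw [sum_apply, Finset.sum_eq_single i, single_self]
  · intro l _ hl
    exact single_ne_left k _ hl.symm _
  · simp

theorem one_apply_ne {i j : V} (h : i ≠ j) : (1 : GenPathAlgebra k A) i j = 0 := by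
  change (∑ l, single k (cls k (APath.nil (1 : A l)))) i j = _
  rw [sum_apply]
  refine Finset.sum_eq_zero fun l _ => ?_
  by_cases hl : i = l
  · exact single_ne_right k _ _ (hl ▸ h.symm)
  · exact single_ne_left k _ hl _

protected theorem one_mul' (f : GenPathAlgebra k A) : 1 * f = f := by
  funext i j
  rw [mul_apply, Finset.sum_eq_single i, one_apply_self, one_compₗ]
  · intro l _ hl
    simp [one_apply_ne k hl.symm]
  · simp

protected theorem mul_one' (f : GenPathAlgebra k A) : f * 1 = f := by
  funext i j
  rw [mul_apply, Finset.sum_eq_single j, one_apply_self, compₗ_one]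
  · intro l _ hl
    simp [one_apply_ne k hl]
  · simp

protected theorem mul_assoc' (f g h : GenPathAlgebra k A) : f * g * h = f * (g * h) := by
  funext i j
  simp only [mul_apply, map_sum, LinearMap.sum_apply, compₗ_assoc]
  exact Finset.sum_comm

instance : Ring (GenPathAlgebra k A) where
  __ := (inferInstance : AddCommGroup (GenPathAlgebra k A))
  mul := (· * ·)
  one := 1
  one_mul := GenPathAlgebra.one_mul' k
  mul_one := GenPathAlgebra.mul_one' k
  mul_assoc := GenPathAlgebra.mul_assoc' k
  zero_mul f := by funext i j; simp [mul_apply]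
  mul_zero f := by funext i j; simp [mul_apply]
  left_distrib f g h := by funext i j; simp [mul_apply, Finset.sum_add_distrib]
  right_distrib f g h := by funext i j; simp [mul_apply, Finset.sum_add_distrib]

instance : Algebra k (GenPathAlgebra k A) :=
  Algebra.ofModule
    (fun c f g => by funext i j; simp [mul_apply, Finset.smul_sum])
    (fun c f g => by funext i j; simp [mul_apply, Finset.smul_sum])

theorem single_mul_single {i j l : V} (f : PathSpace k A i j) (g : PathSpace k A j l) :
    single k f * single k g = single k (compₗ k f g) := by
  funext a b
  rw [mul_apply, Finset.sum_eq_single j]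
  · by_cases ha : a = i
    · subst ha
      by_cases hb : b = l
      · subst hb
        simp [single_self]
      · simp [single_ne_right k _ _ hb]
    · simp [single_ne_left k _ ha]
  · intro m _ hm
    simp [single_ne_left k g hm]
  · simp

/-- The element of the generalized path algebra given by an `A`-path. -/
def ofAPath {i j : V} (p : APath A i j) : GenPathAlgebra k A := single k (cls k p)

/-- The embedding of `A i` as the space of `A`-paths of length `0` at `i`. -/
def vertexIncl (i : V) : A i →ₗ[k] GenPathAlgebra k A where
  toFun a := ofAPath k (APath.nil a)
  map_add' a b := by
    rw [ofAPath, cls_isSum (APath.IsSum.nil a b), map_add]; rfl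
  map_smul' c a := by
    rw [ofAPath, cls_isSMul (APath.IsSMul.nil (c := c) a), map_smul]; rfl

theorem vertexIncl_mul (i : V) (a b : A i) :
    vertexIncl k i (a * b) = vertexIncl k i a * vertexIncl k i b := by
  simp [vertexIncl, ofAPath, single_mul_single, APath.comp, APath.rmul]

/-- The projection of the generalized path algebra onto `A i`, which kills all `A`-paths of
positive length and all those that do not start and end at `i`. -/
def vertexProj (i : V) : GenPathAlgebra k A →ₐ[k] A i :=
  let φ : PathSpace k A i i →ₗ[k] A i :=
    pathLift k APath.entry (fun _ _ _ h => h.entry) (fun _ _ _ h => h.entry)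
  AlgHom.ofLinearMap
    { toFun f := φ (f i i)
      map_add' f g := by simp
      map_smul' c f := by simp }
    (by simp [φ, one_apply_self, APath.entry])
    (by
      intro f g
      have h1 : ∀ f g : PathSpace k A i i, φ (compₗ k f g) = φ f * φ g := by
        intro f g
        have : (compₗ k).compr₂ φ = (LinearMap.mul k (A i)).compl₁₂ φ φ :=
          pathSpace_ext fun p => pathSpace_ext fun q => by simp [φ, APath.entry_comp]
        exact LinearMap.congr_fun (LinearMap.congr_fun this f) g
      have h2 : ∀ l : V, l ≠ i → ∀ (f : PathSpace k A i l) (g : PathSpace k A l i),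
          φ (compₗ k f g) = 0 := by
        intro l hl f g
        have : (compₗ k).compr₂ φ = (0 : PathSpace k A i l →ₗ[k] PathSpace k A l i →ₗ[k] A i) :=
          pathSpace_ext fun p => pathSpace_ext fun q => by
            simp [φ, APath.entry_comp_of_ne hl]
        exact LinearMap.congr_fun (LinearMap.congr_fun this f) g
      change φ ((f * g) i i) = φ (f i i) * φ (g i i)
      rw [mul_apply, map_sum, Finset.sum_eq_single i, h1]
      · intro l _ hl
        exact h2 l hl _ _
      · simp)

theorem vertexProj_ofAPath_cons (i : V) {a b c : V} (p : APath A a b) (β : b ⟶ c) (x : A c) :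
    vertexProj k i (ofAPath k (APath.cons p β x)) = 0 := by
  change pathLift k APath.entry (fun _ _ _ h => h.entry) (fun _ _ _ h => h.entry)
    (single k (cls k (APath.cons p β x)) i i) = 0
  by_cases ha : i = a
  · subst ha
    by_cases hc : i = c
    · subst hc
      simp [single_self, APath.entry]
    · rw [single_ne_right k _ _ hc, map_zero]
  · rw [single_ne_left k _ ha, map_zero]

end GenPathAlgebra

end Algebra

/-! ### Path algebras, admissible ideals and presentations by bound quivers -/

/-- The usual path algebra `kQ`: the generalized path algebra with a copy of `k` at each vertex. -/
abbrev PathAlgebra (k : Type u) [Field k] (Q : Type v) [Quiver.{e} Q] : Type (max u v e) :=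
  GenPathAlgebra k (fun _ : Q => k)

section Admissible

variable (k : Type u) [Field k] {Q : Type v} [Quiver.{e} Q] [Fintype Q]

/-- A path as an element of the path algebra. -/
def pathElement {i j : Q} (p : Quiver.Path i j) : PathAlgebra k Q :=
  GenPathAlgebra.ofAPath k (APath.ofPath p)

variable (Q) in
/-- The `m`-th power of the arrow ideal of `kQ`: the ideal generated by the paths of length `m`. -/
def arrowIdealPow (m : ℕ) : TwoSidedIdeal (PathAlgebra k Q) :=
  TwoSidedIdeal.span {y | ∃ (i j : Q) (p : Quiver.Path i j), p.length = m ∧ y = pathElement k p}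

variable {k} in
/-- A two-sided ideal `I` of `kQ` is admissible if `R ^ m ≤ I ≤ R ^ 2` for some `m ≥ 2`, where `R`
is the arrow ideal. -/
def IsAdmissible (I : TwoSidedIdeal (PathAlgebra k Q)) : Prop :=
  (∃ m : ℕ, 2 ≤ m ∧ arrowIdealPow k Q m ≤ I) ∧ I ≤ arrowIdealPow k Q 2

end Admissible

/-- A finite-dimensional algebra over an algebraically closed field `k` is basic if its quotient by
the Jacobson radical is a finite product of copies of `k`. -/
def IsBasic (k : Type u) [Field k] (B : Type w) [Ring B] [Algebra k B] : Prop :=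
  ∃ n : ℕ, Nonempty ((B ⧸ Ring.jacobson B) ≃ₐ[k] (Fin n → k))

/-- A presentation `B ≅ kQ / Ω` of an algebra by a finite quiver `Q` and an admissible ideal `Ω`,
given by the surjection `kQ → B` with kernel `Ω`. -/
structure BoundQuiverPresentation (k : Type u) [Field k] (B : Type w) [Ring B] [Algebra k B] where
  Vertex : Type
  [quiver : Quiver.{0} Vertex]
  [fintypeVertex : Fintype Vertex]
  [finiteArrows : ∀ i j : Vertex, Finite (i ⟶ j)]
  proj : PathAlgebra k Vertex →ₐ[k] B
  surjective : Function.Surjective proj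
  admissible : IsAdmissible (TwoSidedIdeal.ker proj)

attribute [instance] BoundQuiverPresentation.quiver BoundQuiverPresentation.fintypeVertex

/-- A relation in a quiver: a nonzero linear combination of paths of length at least two with common
source and common target. -/
structure Relation (k : Type u) [Field k] (V : Type v) [Quiver.{e} V] where
  source : V
  target : V
  coeff : Quiver.Path source target →₀ k
  coeff_ne_zero : coeff ≠ 0
  two_le_length : ∀ p ∈ coeff.support, 2 ≤ p.length

/-- The two-sided ideal of `kV` generated by a set of relations. -/
def relationIdeal {k : Type u} [Field k] {V : Type v} [Quiver.{e} V] [Fintype V]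
    (I : Set (Relation k V)) : TwoSidedIdeal (PathAlgebra k V) :=
  TwoSidedIdeal.span {y | ∃ ρ ∈ I, y = ∑ p ∈ ρ.coeff.support, ρ.coeff p • pathElement k p}

/-! ### Generalized bound path algebras -/

section Bound

variable {k : Type u} [Field k] {V : Type v} [Quiver.{e} V] {A : V → Type w}
  [∀ i, Ring (A i)] [∀ i, Algebra k (A i)] (pres : ∀ i, BoundQuiverPresentation k (A i))

/-- `Interleaves pres p q`: the `A`-path `q` is `1 β₁ γ̄₁ β₂ γ̄₂ … γ̄ₘ₋₁ βₘ 1`, where `p = β₁ … βₘ` and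
each `γ̄ₜ` is the image in the algebra at the end of `βₜ` of a path of the quiver presenting it. -/
inductive Interleaves {i : V} : ∀ {j : V}, Quiver.Path i j → APath A i j → Prop
  | nil : Interleaves Quiver.Path.nil (APath.nil 1)
  | arrow {j : V} (β : i ⟶ j) :
      Interleaves (Quiver.Path.cons Quiver.Path.nil β) (APath.cons (APath.nil 1) β 1)
  | cons {j l m : V} {p : Quiver.Path i j} {α : j ⟶ l} {q : APath A i l}
      (h : Interleaves (Quiver.Path.cons p α) q) {a b : (pres l).Vertex} (γ : Quiver.Path a b)
      (β : l ⟶ m) :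
      Interleaves (Quiver.Path.cons (Quiver.Path.cons p α) β)
        (APath.cons (q.rmul ((pres l).proj (pathElement k γ))) β 1)

variable [Fintype V] (I : Set (Relation k V))

/-- The set `A(I)`: in each relation of `I`, images of arbitrary paths of the presenting quivers are
inserted at all inner vertices of the paths that occur, independently for each of them. -/
def relationSet : Set (GenPathAlgebra k A) :=
  {y | ∃ ρ ∈ I, ∃ f : Quiver.Path ρ.source ρ.target → APath A ρ.source ρ.target,
    (∀ p ∈ ρ.coeff.support, Interleaves pres p (f p)) ∧
      y = ∑ p ∈ ρ.coeff.support, ρ.coeff p • GenPathAlgebra.ofAPath k (f p)}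

/-- The generalized bound path algebra `k(V, A, I) = k(V, A) / (A(I))`. -/
abbrev GBPAlgebra : Type (max u v e w) :=
  GenPathAlgebra k A ⧸ (TwoSidedIdeal.span (relationSet pres I)).asIdeal

/-- The quotient map `k(V, A) → k(V, A, I)`. -/
def toGBP : GenPathAlgebra k A →+* GBPAlgebra pres I :=
  Ideal.Quotient.mk _

theorem vertexProj_interleaves (i : V) {a b : V} {p : Quiver.Path a b} {q : APath A a b}
    (h : Interleaves pres p q) (hp : 2 ≤ p.length) :
    GenPathAlgebra.vertexProj k i (GenPathAlgebra.ofAPath k q) = 0 := by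
  cases h with
  | nil => simp at hp
  | arrow β => exact GenPathAlgebra.vertexProj_ofAPath_cons k i _ _ _
  | cons h γ β => exact GenPathAlgebra.vertexProj_ofAPath_cons k i _ _ _

/-- The projection of `k(V, A, I)` onto `A i`. -/
def gbpProj (i : V) : GBPAlgebra pres I →+* A i :=
  Ideal.Quotient.lift _ (GenPathAlgebra.vertexProj (A := A) k i).toRingHom <| by
    have : TwoSidedIdeal.span (relationSet pres I) ≤
        TwoSidedIdeal.ker (GenPathAlgebra.vertexProj (A := A) k i).toRingHom := by
      rw [TwoSidedIdeal.span_le]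
      rintro y ⟨ρ, -, f, hf, rfl⟩
      change _ ∈ TwoSidedIdeal.ker _
      rw [TwoSidedIdeal.mem_ker]
      change GenPathAlgebra.vertexProj k i _ = 0
      simp only [map_sum, map_smul]
      refine Finset.sum_eq_zero fun p hp => ?_
      rw [vertexProj_interleaves pres i (hf p hp) (ρ.two_le_length p hp), smul_zero]
    intro y hy
    exact (TwoSidedIdeal.mem_ker _).1 (this hy)

/-- The element of `k(V, A, I)` given by an element of `A i`. -/
def ofVertex (i : V) (a : A i) : GBPAlgebra pres I :=
  toGBP pres I (GenPathAlgebra.vertexIncl k i a)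

/-- The canonical map `∏ i, A i → k(V, A, I)`. -/
def ofProd (a : ∀ i, A i) : GBPAlgebra pres I := ∑ i, ofVertex pres I i (a i)

theorem ofVertex_add (i : V) (a b : A i) :
    ofVertex pres I i (a + b) = ofVertex pres I i a + ofVertex pres I i b := by
  simp [ofVertex]

theorem ofVertex_zero (i : V) : ofVertex pres I i (0 : A i) = 0 := by
  simp [ofVertex]

theorem ofVertex_mul (i : V) (a b : A i) :
    ofVertex pres I i (a * b) = ofVertex pres I i a * ofVertex pres I i b := by
  simp [ofVertex, GenPathAlgebra.vertexIncl_mul]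

/-! ### Modules over generalized bound path algebras -/

/-- The natural inclusion of an `A i`-module as a `k(V, A, I)`-module: the underlying space is `M`,
placed at the vertex `i`, and all arrows act as zero. -/
@[nolint unusedArguments]
def NaturalInclusion (_pres : ∀ i, BoundQuiverPresentation k (A i)) (_I : Set (Relation k V)) (i : V)
    (M : Type x) [AddCommGroup M] [Module (A i)ᵐᵒᵖ M] : Type x := M

instance (i : V) (M : Type x) [AddCommGroup M] [Module (A i)ᵐᵒᵖ M] :
    AddCommGroup (NaturalInclusion pres I i M) :=
  inferInstanceAs (AddCommGroup M)

instance (i : V) (M : Type x) [AddCommGroup M] [Module (A i)ᵐᵒᵖ M] :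
    Module (GBPAlgebra pres I)ᵐᵒᵖ (NaturalInclusion pres I i M) :=
  Module.compHom M (RingHom.op (gbpProj pres I i))

/-- The relations `m · a ⊗ y = m ⊗ a y` for `a ∈ ∏ j, A j`, which acts on the `A i`-module `M`
through its `i`-th component. -/
def coneRel (i : V) (M : Type x) [AddCommGroup M] [Module k M] [Module (A i)ᵐᵒᵖ M] :
    Submodule (GBPAlgebra pres I)ᵐᵒᵖ (GBPAlgebra pres I ⊗[k] M) :=
  Submodule.span _ {z | ∃ (m : M) (a : ∀ j, A j) (y : GBPAlgebra pres I),
    z = y ⊗ₜ[k] (MulOpposite.op (a i) • m) - (ofProd pres I a * y) ⊗ₜ[k] m}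

/-- The cone over an `A i`-module `M`: the extension of scalars `M ⊗ k(V, A, I)` over `∏ j, A j`.
The tensor product over this noncommutative ring is written as a quotient of the tensor product over
`k`, with the factors in the other order, so that `k(V, A, I)` acts by right multiplication on the
first factor. -/
abbrev Cone (i : V) (M : Type x) [AddCommGroup M] [Module k M] [Module (A i)ᵐᵒᵖ M] :
    Type (max u v e w x) :=
  (GBPAlgebra pres I ⊗[k] M) ⧸ coneRel pres I i M

section Component

variable (L : Type x) [AddCommGroup L] [Module (GBPAlgebra pres I)ᵐᵒᵖ L]

/-- The component `L · 1_j` of a `k(V, A, I)`-module `L` at the vertex `j`. -/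
def component (j : V) : AddSubgroup L where
  carrier := {y | MulOpposite.op (ofVertex pres I j 1) • y = y}
  zero_mem' := smul_zero _
  add_mem' {y z} hy hz := by
    change _ • (y + z) = y + z
    rw [smul_add, hy, hz]
  neg_mem' {y} hy := by
    change _ • (-y) = -y
    rw [smul_neg, hy]

/-- `A j` acts on the component of `L` at `j` through `A j → k(V, A, I)`. -/
instance (j : V) : Module (A j)ᵐᵒᵖ (component pres I L j) where
  smul a y := ⟨MulOpposite.op (ofVertex pres I j a.unop) • (y : L), by
    change _ • _ • (y : L) = _
    rw [← mul_smul, ← MulOpposite.op_mul, ← ofVertex_mul, mul_one]⟩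
  one_smul y := Subtype.ext y.2
  mul_smul a b y := Subtype.ext <| by
    change MulOpposite.op (ofVertex pres I j (b.unop * a.unop)) • (y : L) = _ • _ • (y : L)
    rw [ofVertex_mul, MulOpposite.op_mul, mul_smul]
  smul_zero a := Subtype.ext (smul_zero _)
  smul_add a y z := Subtype.ext (smul_add _ _ _)
  add_smul a b y := Subtype.ext <| by
    change MulOpposite.op (ofVertex pres I j (a.unop + b.unop)) • (y : L) = _ • (y : L) + _ • (y : L)
    rw [ofVertex_add, MulOpposite.op_add, add_smul]
  zero_smul y := Subtype.ext <| by
    change MulOpposite.op (ofVertex pres I j (0 : A j)) • (y : L) = 0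
    rw [ofVertex_zero, MulOpposite.op_zero, zero_smul]

/-- The support of a `k(V, A, I)`-module: the vertices with nonzero component. -/
def support : Set V := {j | component pres I L j ≠ ⊥}

end Component

end Bound

/-- `g : P → M` is a projective cover: `P` is projective, and `g` is surjective with superfluous
kernel. -/
structure IsProjectiveCover {R : Type u} [Ring R] {P : Type v} {M : Type w} [AddCommGroup P]
    [AddCommGroup M] [Module R P] [Module R M] (g : P →ₗ[R] M) : Prop where
  projective : Module.Projective R P
  surjective : Function.Surjective g
  superfluous : ∀ N : Submodule R P, N ⊔ LinearMap.ker g = ⊤ → N = ⊤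

end GBP

end

/-! Write `Λ` for the generalized bound path algebra, `e_j` for the unit of `A j` inside `Λ`, and
`D` for the right ideal of `Λ` generated by the arrows starting at `i` (`arrowIdeal`). In every
relation the inserted elements sit at inner vertices only, so each `A`-path occurring in it has
first and last entry `1`. Three consequences of this carry the proof.

At the start: a multiple of a relation is linear in its first entry, hence `e_i Λ` is `A i ⊕ (A i ⊗
D)`, tensors being over `k`. Consequently the cone over an `A i`-module `N` is, as a space, `N ⊕ (D
⊗ N)`. The second summand is a `Λ`-submodule that depends only on the vector space `N`: it is a sum
of `dim N` copies of `D`. The two coordinates are `coneFst`, built from the projection `Λ → A i`,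
and `coneSnd`, built from `splitHead`; `cone_eq_add` says that they determine an element.

The kernel of the map from the cone over `P` to `M` is then `Ker g ⊕ (D ⊗ P)`. Over the field `k`
the map `g` has a section, given by lifts `q s` of a basis of `M`, so `D ⊗ P` is `(D ⊗ Ker g) ⊕ (D ⊗
M)`. The summands `Ker g` and `D ⊗ Ker g` form the cone over `Ker g`, and `L = D ⊗ M` is a finite
power of `D`. This is `kernelMap_injective` and `exact_kernelMap`. It remains to study `D`.

At the end: `D e_j` is `Z ⊗ A j`, where `Z` is spanned by the paths in `D` with last entry `1` at
`j`, so it is free over `A j` (`free_component_arrowIdeal`). It vanishes unless an arrow from `i`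
can be continued to `j`, and acyclicity then excludes `j = i`.

If no relation starts at `i`, removing the first arrow is well defined on `D`. This splits the map
from a finite power of `Λ` onto `D` that multiplies by the arrows, and `D` is projective
(`projective_arrowIdeal`). -/

noncomputable section

namespace GBP

/-! ### The left normal form of an `A`-path -/

namespace APath

section

variable {k : Type u} [Field k] {V : Type v} [Quiver.{e} V] {A : V → Type w}

/-- The `A`-path `h β q`. -/
def push {a l : V} (h : A a) (β : a ⟶ l) : ∀ {b : V}, APath A l b → APath A a b
  | _, nil x => cons (nil h) β x
  | _, cons q γ x => cons (push h β q) γ x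

/-- Definition of a function on `A`-paths by giving it on paths of length zero and on paths `h β q`. -/
def consElim {X : Type*} {a : V} (z : A a → X) :
    ∀ {b : V}, (∀ l, A a → (a ⟶ l) → APath A l b → X) → APath A a b → X
  | _, _, nil x => z x
  | _, F, cons (nil h) β x => F _ h β (nil x)
  | _, F, cons (cons p γ y) β x => consElim z (fun l h δ q => F l h δ (cons q β x)) (cons p γ y)

@[simp]
theorem consElim_nil {X : Type*} {a : V} (z : A a → X)
    (F : ∀ l, A a → (a ⟶ l) → APath A l a → X) (x : A a) : consElim z F (nil x) = z x := rfl

-- `consElim` peels entries off the right end and stores them in `F` until only the first arrow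
-- remains; the induction therefore needs `F` to vary.
@[simp]
theorem consElim_push {X : Type*} {a l : V} (z : A a → X) (h : A a) (β : a ⟶ l) {b : V}
    (q : APath A l b) (F : ∀ l, A a → (a ⟶ l) → APath A l b → X) :
    consElim z F (push h β q) = F l h β q := by
  induction q with
  | nil x => rfl
  | cons q γ x ih =>
    have := ih (fun l h δ q => F l h δ (cons q γ x))
    cases q <;> exact this

/-- `A`-paths grow at their right end; this is the case analysis at the left end, where cones and
the arrow ideal are read. -/
theorem push_cases {a : V} {motive : ∀ b, APath A a b → Prop} (nil : ∀ x, motive a (nil x))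
    (push : ∀ l b (h : A a) (β : a ⟶ l) (q : APath A l b), motive b (push h β q)) {b : V}
    (p : APath A a b) : motive b p := by
  induction p with
  | nil x => exact nil x
  | cons p β x ih =>
    clear ih
    suffices ∀ {c d : V} (p : APath A a c) (β : c ⟶ d) (x : A d),
        ∃ l h, ∃ γ : a ⟶ l, ∃ q, cons p β x = APath.push h γ q by
      obtain ⟨l, h, γ, q, e⟩ := this p β x
      exact e ▸ push _ _ h γ q
    intro c d p β x
    induction p generalizing d with
    | nil h => exact ⟨_, h, β, .nil x, rfl⟩
    | cons p δ y ih =>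
      obtain ⟨l, h, γ, q, e⟩ := ih δ y
      exact ⟨l, h, γ, .cons q β x, by rw [e]; rfl⟩

theorem eq_nil_or_push {a b : V} (p : APath A a b) :
    (∃ x, ∃ e : a = b, p = e ▸ nil x) ∨ ∃ l h, ∃ β : a ⟶ l, ∃ q, p = push h β q := by
  induction p using push_cases with
  | nil x => exact .inl ⟨x, rfl, rfl⟩
  | push l b h β q => exact .inr ⟨l, h, β, q, rfl⟩

theorem nonempty_path {a b : V} (p : APath A a b) : Nonempty (Quiver.Path a b) := by
  induction p with
  | nil x => exact ⟨.nil⟩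
  | cons p β x ih => exact ih.map (·.cons β)

variable [∀ i, Ring (A i)] [∀ i, Algebra k (A i)]

theorem push_comp {a l b c : V} (h : A a) (β : a ⟶ l) (q : APath A l b) (r : APath A b c) :
    (push h β q).comp r = push h β (q.comp r) := by
  induction r with
  | nil x => cases q <;> rfl
  | cons r γ x ih => simp only [comp, push, ih]

theorem nil_comp_push {a l b : V} (x h : A a) (β : a ⟶ l) (q : APath A l b) :
    (nil x).comp (push h β q) = push (x * h) β q := by
  induction q with
  | nil x => rfl
  | cons q γ x ih => simp only [comp, push, ih]

theorem push_eq_comp {a l b : V} (h : A a) (β : a ⟶ l) (q : APath A l b) :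
    push h β q = (nil h).comp ((push 1 β (nil 1)).comp q) := by
  rw [push_comp, nil_comp_push, mul_one, one_comp]

/-- `IsSum` locates the modified entry from the right. Here it is located from the left: in a path
of length zero, in the first entry, or behind the first arrow. Additivity of functions given by
`consElim` is checked in these three cases. -/
theorem IsSum.exists_push {a b : V} {p p₁ p₂ : APath A a b} (hp : IsSum p p₁ p₂) :
    (∃ x y, ∃ e : a = b, p = e ▸ APath.nil (x + y) ∧ p₁ = e ▸ APath.nil x ∧
      p₂ = e ▸ APath.nil y) ∨
    (∃ l h h', ∃ β : a ⟶ l, ∃ q, p = push (h + h') β q ∧ p₁ = push h β q ∧ p₂ = push h' β q) ∨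
    ∃ l h, ∃ β : a ⟶ l, ∃ q q₁ q₂, IsSum q q₁ q₂ ∧ p = push h β q ∧ p₁ = push h β q₁ ∧
      p₂ = push h β q₂ := by
  induction hp with
  | nil x y => exact .inl ⟨x, y, rfl, rfl, rfl, rfl⟩
  | last p β x y =>
    refine .inr (.inr ?_)
    induction p using push_cases with
    | nil h => exact ⟨_, h, β, _, _, _, .nil x y, rfl, rfl, rfl⟩
    | push l b h γ q => exact ⟨_, h, γ, _, _, _, .last q β x y, rfl, rfl, rfl⟩
  | cons hp β z ih =>
    obtain ⟨x, y, rfl, rfl, rfl, rfl⟩ | ⟨l, h, h', γ, q, rfl, rfl, rfl⟩ |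
      ⟨l, h, γ, q, q₁, q₂, hq, rfl, rfl, rfl⟩ := ih
    · exact .inr (.inl ⟨_, x, y, β, .nil z, rfl, rfl, rfl⟩)
    · exact .inr (.inl ⟨_, h, h', γ, .cons q β z, rfl, rfl, rfl⟩)
    · exact .inr (.inr ⟨_, h, γ, _, _, _, .cons hq β z, rfl, rfl, rfl⟩)

theorem IsSMul.exists_push {c : k} {a b : V} {p p₁ : APath A a b} (hp : IsSMul c p p₁) :
    (∃ x, ∃ e : a = b, p = e ▸ APath.nil (c • x) ∧ p₁ = e ▸ APath.nil x) ∨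
    (∃ l h, ∃ β : a ⟶ l, ∃ q, p = push (c • h) β q ∧ p₁ = push h β q) ∨
    ∃ l h, ∃ β : a ⟶ l, ∃ q q₁, IsSMul c q q₁ ∧ p = push h β q ∧ p₁ = push h β q₁ := by
  induction hp with
  | nil x => exact .inl ⟨x, rfl, rfl, rfl⟩
  | last p β x =>
    refine .inr (.inr ?_)
    induction p using push_cases with
    | nil h => exact ⟨_, h, β, _, _, .nil x, rfl, rfl⟩
    | push l b h γ q => exact ⟨_, h, γ, _, _, .last q β x, rfl, rfl⟩
  | cons hp β z ih =>
    obtain ⟨x, rfl, rfl, rfl⟩ | ⟨l, h, γ, q, rfl, rfl⟩ | ⟨l, h, γ, q, q₁, hq, rfl, rfl⟩ := ih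
    · exact .inr (.inl ⟨_, x, β, .nil z, rfl, rfl⟩)
    · exact .inr (.inl ⟨_, h, γ, .cons q β z, rfl, rfl⟩)
    · exact .inr (.inr ⟨_, h, γ, _, _, .cons hq β z, rfl, rfl⟩)

end

end APath

/-! ### Linear maps out of a generalized bound path algebra -/

section Lift

variable {k : Type u} [Field k] {V : Type v} [Quiver.{e} V] {A : V → Type w}
  [∀ i, Ring (A i)] [∀ i, Algebra k (A i)] (pres : ∀ i, BoundQuiverPresentation k (A i))
  [Fintype V] (I : Set (Relation k V))

/-- The class of an `A`-path in the generalized bound path algebra. -/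
def ap {a b : V} (p : APath A a b) : GBPAlgebra pres I := toGBP pres I (GenPathAlgebra.ofAPath k p)

theorem toGBP_smul (c : k) (f : GenPathAlgebra k A) :
    toGBP pres I (c • f) = c • toGBP pres I f := rfl

theorem ap_mul {a b c : V} (p : APath A a b) (q : APath A b c) :
    ap pres I p * ap pres I q = ap pres I (p.comp q) := by
  rw [ap, ap, ← map_mul, GenPathAlgebra.ofAPath, GenPathAlgebra.ofAPath,
    GenPathAlgebra.single_mul_single, compₗ_cls]
  rfl

theorem single_mul_single_of_ne {a b b' c : V} (h : b ≠ b') (f : PathSpace k A a b)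
    (g : PathSpace k A b' c) : GenPathAlgebra.single k f * GenPathAlgebra.single k g = 0 := by
  funext i j
  rw [GenPathAlgebra.mul_apply]
  refine Finset.sum_eq_zero fun l _ => ?_
  by_cases hl : l = b
  · rw [GenPathAlgebra.single_ne_left k g (hl ▸ h), map_zero]
  · rw [GenPathAlgebra.single_ne_right k f _ hl, map_zero, LinearMap.zero_apply]

theorem ap_mul_of_ne {a b b' c : V} (h : b ≠ b') (p : APath A a b) (q : APath A b' c) :
    ap pres I p * ap pres I q = 0 := by
  rw [ap, ap, ← map_mul, GenPathAlgebra.ofAPath, GenPathAlgebra.ofAPath,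
    single_mul_single_of_ne h, map_zero]

theorem ap_isSum {a b : V} {p p₁ p₂ : APath A a b} (h : APath.IsSum p p₁ p₂) :
    ap pres I p = ap pres I p₁ + ap pres I p₂ := by
  rw [ap, GenPathAlgebra.ofAPath, cls_isSum h, map_add, map_add]; rfl

theorem ap_isSMul {c : k} {a b : V} {p q : APath A a b} (h : APath.IsSMul c p q) :
    ap pres I p = c • ap pres I q := by
  rw [ap, GenPathAlgebra.ofAPath, cls_isSMul h, map_smul, toGBP_smul]; rfl

theorem ofVertex_eq (j : V) (x : A j) : ofVertex pres I j x = ap pres I (APath.nil x) := rfl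

theorem sum_coeff_smul_ap {ρ : Relation k V} (hρ : ρ ∈ I)
    {f : Quiver.Path ρ.source ρ.target → APath A ρ.source ρ.target}
    (hf : ∀ p ∈ ρ.coeff.support, Interleaves pres p (f p)) :
    ∑ p ∈ ρ.coeff.support, ρ.coeff p • ap pres I (f p) = 0 := by
  have h : (∑ p ∈ ρ.coeff.support, ρ.coeff p • GenPathAlgebra.ofAPath k (f p)) ∈
      (TwoSidedIdeal.span (relationSet pres I)).asIdeal :=
    TwoSidedIdeal.mem_asIdeal.2 (TwoSidedIdeal.subset_span ⟨ρ, hρ, f, hf, rfl⟩)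
  have h' : toGBP pres I (∑ p ∈ ρ.coeff.support, ρ.coeff p • GenPathAlgebra.ofAPath k (f p)) = 0 :=
    Ideal.Quotient.eq_zero_iff_mem.2 h
  rwa [map_sum] at h'

theorem span_ofAPath :
    Submodule.span k {y : GenPathAlgebra k A | ∃ a b, ∃ p : APath A a b,
      y = GenPathAlgebra.ofAPath k p} = ⊤ := by
  classical
  rw [eq_top_iff]
  intro f _
  have hf : f = ∑ a, ∑ b, GenPathAlgebra.single k (f a b) := by
    funext i j
    rw [GenPathAlgebra.sum_apply, Finset.sum_eq_single i, GenPathAlgebra.sum_apply,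
      Finset.sum_eq_single j, GenPathAlgebra.single_self]
    · intro b _ hb
      exact GenPathAlgebra.single_ne_right k _ _ hb.symm
    · simp
    · intro a _ ha
      rw [GenPathAlgebra.sum_apply]
      exact Finset.sum_eq_zero fun b _ => GenPathAlgebra.single_ne_left k _ ha.symm _
    · simp
  rw [hf]
  refine Submodule.sum_mem _ fun a _ => Submodule.sum_mem _ fun b _ => ?_
  induction f a b using pathSpace_induction with
  | cls p => exact Submodule.subset_span ⟨a, b, p, rfl⟩
  | zero => simp
  | add g g' hg hg' => rw [map_add]; exact Submodule.add_mem _ hg hg'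
  | smul c g hg => rw [map_smul]; exact Submodule.smul_mem _ c hg

variable {pres I} in
@[elab_as_elim]
theorem gbp_induction {motive : GBPAlgebra pres I → Prop}
    (ap : ∀ a b (p : APath A a b), motive (ap pres I p)) (zero : motive 0)
    (add : ∀ f g, motive f → motive g → motive (f + g))
    (smul : ∀ (c : k) f, motive f → motive (c • f)) (f : GBPAlgebra pres I) : motive f := by
  obtain ⟨f, rfl⟩ := Ideal.Quotient.mk_surjective f
  have hf : f ∈ Submodule.span k {y : GenPathAlgebra k A | ∃ a b, ∃ p : APath A a b,
      y = GenPathAlgebra.ofAPath k p} := by rw [span_ofAPath]; trivial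
  induction hf using Submodule.span_induction with
  | mem y hy =>
    obtain ⟨a, b, p, rfl⟩ := hy
    exact ap a b p
  | zero => exact zero
  | add y z _ _ hy hz => exact add _ _ hy hz
  | smul c y _ hy => exact smul c _ hy

variable {X : Type x} [AddCommGroup X] [Module k X] (F : ∀ a b, APath A a b → X)

/-- The linear map out of the generalized path algebra given by a multilinear function. -/
def genLift (hadd : ∀ a b (p p₁ p₂ : APath A a b), APath.IsSum p p₁ p₂ →
      F a b p = F a b p₁ + F a b p₂)
    (hsmul : ∀ a b (c : k) (p q : APath A a b), APath.IsSMul c p q → F a b p = c • F a b q) :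
    GenPathAlgebra k A →ₗ[k] X where
  toFun f := ∑ a, ∑ b, pathLift k (F a b) (hadd a b) (hsmul a b) (f a b)
  map_add' f g := by simp [Finset.sum_add_distrib]
  map_smul' c f := by simp [Finset.smul_sum]

theorem genLift_ofAPath (hadd hsmul) {a b : V} (p : APath A a b) :
    genLift F hadd hsmul (GenPathAlgebra.ofAPath k p) = F a b p := by
  change ∑ i, ∑ j, pathLift k (F i j) (hadd i j) (hsmul i j)
    (GenPathAlgebra.single k (cls k p) i j) = _
  rw [Finset.sum_eq_single a, Finset.sum_eq_single b, GenPathAlgebra.single_self, pathLift_cls]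
  · intro j _ hj
    rw [GenPathAlgebra.single_ne_right k _ _ hj, map_zero]
  · simp
  · intro i _ hi
    exact Finset.sum_eq_zero fun j _ => by rw [GenPathAlgebra.single_ne_left k _ hi, map_zero]
  · simp

/-- The linear map out of the generalized bound path algebra given by a multilinear function that
vanishes on all multiples of the relations. -/
def gbpLift (hadd : ∀ a b (p p₁ p₂ : APath A a b), APath.IsSum p p₁ p₂ →
      F a b p = F a b p₁ + F a b p₂)
    (hsmul : ∀ a b (c : k) (p q : APath A a b), APath.IsSMul c p q → F a b p = c • F a b q)
    (hrel : ∀ ρ ∈ I, ∀ f : Quiver.Path ρ.source ρ.target → APath A ρ.source ρ.target,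
      (∀ p ∈ ρ.coeff.support, Interleaves pres p (f p)) →
      ∀ a b (s : APath A a ρ.source) (t : APath A ρ.target b),
        ∑ p ∈ ρ.coeff.support, ρ.coeff p • F a b (s.comp ((f p).comp t)) = 0) :
    GBPAlgebra pres I →ₗ[k] X where
  __ := QuotientAddGroup.lift
    (TwoSidedIdeal.span (relationSet pres I)).asIdeal.toAddSubgroup
    (genLift F hadd hsmul).toAddMonoidHom <| by
      classical
      intro z hz
      replace hz : z ∈ TwoSidedIdeal.span (relationSet pres I) := TwoSidedIdeal.mem_asIdeal.1 hz
      -- The ideal is additively generated by the products `s ρ t`. By linearity `s` and `t` may be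
      -- taken to be `A`-paths, and the product is zero unless their ends fit those of `ρ`.
      rw [TwoSidedIdeal.mem_span_iff_mem_addSubgroup_closure] at hz
      refine (AddSubgroup.closure_le (K := (genLift F hadd hsmul).toAddMonoidHom.ker)).2 ?_ hz
      rintro _ ⟨_, ⟨s, -, _, ⟨ρ, hρ, f, hf, rfl⟩, rfl⟩, t, -, rfl⟩
      change genLift F hadd hsmul (s * (∑ p ∈ ρ.coeff.support,
        ρ.coeff p • GenPathAlgebra.ofAPath k (f p)) * t) = 0
      have hs : s ∈ Submodule.span k {y : GenPathAlgebra k A | ∃ a b, ∃ p : APath A a b,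
        y = GenPathAlgebra.ofAPath k p} := by rw [span_ofAPath]; trivial
      have ht : t ∈ Submodule.span k {y : GenPathAlgebra k A | ∃ a b, ∃ p : APath A a b,
        y = GenPathAlgebra.ofAPath k p} := by rw [span_ofAPath]; trivial
      induction hs using Submodule.span_induction with
      | zero => rw [zero_mul, zero_mul, map_zero]
      | add y z _ _ hy hz => rw [add_mul, add_mul, map_add, hy, hz, add_zero]
      | smul c y _ hy => rw [smul_mul_assoc, smul_mul_assoc, map_smul, hy, smul_zero]
      | mem y hy =>
        obtain ⟨a, a', s, rfl⟩ := hy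
        induction ht using Submodule.span_induction with
        | zero => rw [mul_zero, map_zero]
        | add y z _ _ hy hz => rw [mul_add, map_add, hy, hz, add_zero]
        | smul c y _ hy => rw [mul_smul_comm, map_smul, hy, smul_zero]
        | mem y hy =>
          obtain ⟨b', b, t, rfl⟩ := hy
          rw [Finset.mul_sum, Finset.sum_mul, map_sum]
          by_cases ha : a' = ρ.source
          · by_cases hb : ρ.target = b'
            · subst ha hb
              rw [← hrel ρ hρ f hf a b s t]
              refine Finset.sum_congr rfl fun p _ => ?_
              rw [mul_smul_comm, smul_mul_assoc, map_smul, mul_assoc, ← genLift_ofAPath F hadd hsmul]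
              simp only [GenPathAlgebra.ofAPath, GenPathAlgebra.single_mul_single, compₗ_cls]
            · refine Finset.sum_eq_zero fun p _ => ?_
              rw [mul_smul_comm, smul_mul_assoc, mul_assoc, GenPathAlgebra.ofAPath,
                GenPathAlgebra.ofAPath, GenPathAlgebra.ofAPath, single_mul_single_of_ne hb, mul_zero,
                smul_zero, map_zero]
          · refine Finset.sum_eq_zero fun p _ => ?_
            rw [mul_smul_comm, GenPathAlgebra.ofAPath, GenPathAlgebra.ofAPath,
              single_mul_single_of_ne ha, smul_zero, zero_mul, map_zero]
  map_smul' c f := by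
    obtain ⟨f, rfl⟩ := Ideal.Quotient.mk_surjective f
    exact map_smul (genLift F hadd hsmul) c f

@[simp]
theorem gbpLift_ap (hadd hsmul hrel) {a b : V} (p : APath A a b) :
    gbpLift pres I F hadd hsmul hrel (ap pres I p) = F a b p :=
  genLift_ofAPath F hadd hsmul p

end Lift

/-! ### Splitting off the first entry, the first arrow and the last entry of an `A`-path -/

section Split

variable {k : Type u} [Field k] {V : Type v} [Quiver.{e} V] {A : V → Type w}
  [∀ i, Ring (A i)] [∀ i, Algebra k (A i)] {pres : ∀ i, BoundQuiverPresentation k (A i)}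

/-- Nothing is inserted at the source of a relation, so the first entry is `1`. This makes
`splitHead` compatible with the relations. -/
theorem Interleaves.exists_push {a b : V} {p : Quiver.Path a b} {q : APath A a b}
    (h : Interleaves pres p q) (hp : p.length ≠ 0) :
    ∃ l, ∃ β : a ⟶ l, ∃ r, q = APath.push 1 β r := by
  induction h with
  | nil => exact absurd rfl hp
  | arrow β => exact ⟨_, β, .nil 1, rfl⟩
  | @cons _ _ _ _ _ _ h _ _ γ β ih =>
    obtain ⟨l, δ, r, rfl⟩ := ih (by simp)
    exact ⟨l, δ, .cons (r.comp (.nil ((pres _).proj (pathElement k γ)))) β 1,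
      congrArg (APath.cons · β 1) (APath.push_comp 1 δ r (.nil ((pres _).proj (pathElement k γ))))⟩

theorem Interleaves.exists_cons {a b : V} {p : Quiver.Path a b} {q : APath A a b}
    (h : Interleaves pres p q) (hp : p.length ≠ 0) :
    ∃ l, ∃ r : APath A a l, ∃ β : l ⟶ b, q = APath.cons r β 1 := by
  cases h with
  | nil => exact absurd rfl hp
  | arrow β => exact ⟨_, _, β, rfl⟩
  | cons h γ β => exact ⟨_, _, β, rfl⟩

theorem Relation.length_ne_zero (ρ : Relation k V) {p : Quiver.Path ρ.source ρ.target}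
    (hp : p ∈ ρ.coeff.support) : p.length ≠ 0 := by
  have := ρ.two_le_length p hp
  omega

variable [Fintype V] {I : Set (Relation k V)}

/-- The tool for the relation hypothesis of `gbpLift`: it suffices to express the function on
multiples of a relation through a linear map already defined on `Λ`. -/
theorem sum_coeff_smul_ap_mul {ρ : Relation k V} (hρ : ρ ∈ I)
    {f : Quiver.Path ρ.source ρ.target → APath A ρ.source ρ.target}
    (hf : ∀ p ∈ ρ.coeff.support, Interleaves pres p (f p)) {X : Type*} [AddCommGroup X] [Module k X]
    (φ : GBPAlgebra pres I →ₗ[k] X) (s t : GBPAlgebra pres I) :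
    ∑ p ∈ ρ.coeff.support, ρ.coeff p • φ (s * ap pres I (f p) * t) = 0 := by
  have := congrArg (fun y => φ (s * y * t)) (sum_coeff_smul_ap pres I hρ hf)
  simpa [Finset.mul_sum, Finset.sum_mul] using this

variable (pres I)

open Classical in
/-- The map `h β q ↦ (1 β q) ⊗ h` on `A`-paths of positive length starting at `i`; all other `A`-paths
are sent to zero. -/
def splitHead (i : V) : GBPAlgebra pres I →ₗ[k] GBPAlgebra pres I ⊗[k] A i :=
  gbpLift pres I
    (fun a _ p => p.consElim (fun _ => 0)
      -- `Pi.single a h` evaluated at `i` is `h` if `a = i` and `0` otherwise, which avoids a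
      -- transport along `a = i`.
      (fun _ h β q => ap pres I (APath.push 1 β q) ⊗ₜ (Pi.single a h : ∀ j, A j) i))
    (fun a b p p₁ p₂ hp => by
      obtain ⟨x, y, rfl, rfl, rfl, rfl⟩ | ⟨l, h, h', β, q, rfl, rfl, rfl⟩ |
        ⟨l, h, β, q, q₁, q₂, hq, rfl, rfl, rfl⟩ := hp.exists_push
      · simp
      · simp [Pi.single_add, TensorProduct.tmul_add]
      · have := ap_isSum pres I (hq.comp_left (APath.push (1 : A a) β (.nil 1)))
        simp only [APath.push_comp, APath.one_comp] at this
        simp [this, TensorProduct.add_tmul])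
    (fun a b c p p₁ hp => by
      obtain ⟨x, rfl, rfl, rfl⟩ | ⟨l, h, β, q, rfl, rfl⟩ |
        ⟨l, h, β, q, q₁, hq, rfl, rfl⟩ := hp.exists_push
      · simp
      · simp [Pi.single_smul]
      · have := ap_isSMul pres I (hq.comp_left (APath.push (1 : A a) β (.nil 1)))
        simp only [APath.push_comp, APath.one_comp] at this
        simp [this, TensorProduct.smul_tmul'])
    (fun ρ hρ f hf a b s t => by
      let φ (x : A i) := (TensorProduct.mk k (GBPAlgebra pres I) (A i)).flip x
      -- The first entry of `s (f p) t` does not depend on `p`: it is `x` if `s` has length zero,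
      -- since `f p` begins with `1`, and the first entry of `s` otherwise. What remains after
      -- setting it to `1` is a multiple of the relation.
      obtain ⟨x, rfl, rfl⟩ | ⟨l, h, β, q, rfl⟩ := s.eq_nil_or_push
      · refine Eq.trans (Finset.sum_congr rfl fun p hp => ?_) (sum_coeff_smul_ap_mul hρ hf
          (φ ((Pi.single ρ.source x : ∀ j, A j) i)) 1 (ap pres I t))
        obtain ⟨l, β, r, hr⟩ := (hf p hp).exists_push (ρ.length_ne_zero hp)
        rw [one_mul, ap_mul, hr, APath.push_comp, APath.nil_comp_push, APath.consElim_push, mul_one]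
        rfl
      · refine Eq.trans (Finset.sum_congr rfl fun p hp => ?_) (sum_coeff_smul_ap_mul hρ hf
          (φ ((Pi.single a h : ∀ j, A j) i)) (ap pres I (.push 1 β q)) (ap pres I t))
        rw [APath.push_comp, APath.consElim_push, mul_assoc, ap_mul, ap_mul, APath.push_comp]
        rfl)

open Classical in
theorem splitHead_push (i : V) {a l b : V} (h : A a) (β : a ⟶ l) (q : APath A l b) :
    splitHead pres I i (ap pres I (APath.push h β q)) =
      ap pres I (APath.push 1 β q) ⊗ₜ (Pi.single a h : ∀ j, A j) i := by
  rw [splitHead, gbpLift_ap, APath.consElim_push]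

theorem splitHead_nil (i : V) {a : V} (h : A a) :
    splitHead pres I i (ap pres I (APath.nil h)) = 0 := by
  rw [splitHead, gbpLift_ap, APath.consElim_nil]

open Classical in
/-- The value of `splitLast` on an `A`-path. -/
def splitLastFun (j : V) {a : V} : ∀ {b : V}, APath A a b → GBPAlgebra pres I ⊗[k] A j
  | _, .nil _ => 0
  | c, .cons p β x => ap pres I (.cons p β 1) ⊗ₜ (Pi.single c x : ∀ j, A j) j

open Classical in
/-- The map `q β x ↦ (q β 1) ⊗ x` on `A`-paths of positive length ending at `j`; all other `A`-paths
are sent to zero. -/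
def splitLast (j : V) : GBPAlgebra pres I →ₗ[k] GBPAlgebra pres I ⊗[k] A j :=
  gbpLift pres I (fun _ _ p => splitLastFun pres I j p)
    (fun a b p p₁ p₂ hp => by
      cases hp with
      | nil x y => simp [splitLastFun]
      | last p β x y => simp [splitLastFun, Pi.single_add, TensorProduct.tmul_add]
      | cons hp β x =>
        simp [splitLastFun, ap_isSum pres I (hp.cons β 1), TensorProduct.add_tmul])
    (fun a b c p p₁ hp => by
      cases hp with
      | nil x => simp [splitLastFun]
      | last p β x => simp [splitLastFun, Pi.single_smul]
      | cons hp β x =>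
        simp [splitLastFun, ap_isSMul pres I (hp.cons β 1), TensorProduct.smul_tmul'])
    (fun ρ hρ f hf a b s t => by
      let φ (x : A j) := (TensorProduct.mk k (GBPAlgebra pres I) (A j)).flip x
      cases t with
      -- The mirror image of the argument for `splitHead`: here `f p` ends with the entry `1`, so
      -- the last entry of the product is `x` for every `p`.
      | nil x =>
        refine Eq.trans (Finset.sum_congr rfl fun p hp => ?_) (sum_coeff_smul_ap_mul hρ hf
          (φ ((Pi.single ρ.target x : ∀ j, A j) j)) (ap pres I s) 1)
        obtain ⟨l, r, β, hr⟩ := (hf p hp).exists_cons (ρ.length_ne_zero hp)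
        rw [mul_one, ap_mul, hr]
        simp [APath.comp, APath.rmul, splitLastFun, φ]
      | cons t β x =>
        refine Eq.trans (Finset.sum_congr rfl fun p hp => ?_) (sum_coeff_smul_ap_mul hρ hf
          (φ ((Pi.single b x : ∀ j, A j) j)) (ap pres I s) (ap pres I (.cons t β 1)))
        rw [ap_mul, ap_mul, APath.comp_assoc]
        rfl)

open Classical in
theorem splitLast_cons (j : V) {a b c : V} (p : APath A a b) (β : b ⟶ c) (x : A c) :
    splitLast pres I j (ap pres I (.cons p β x)) =
      ap pres I (.cons p β 1) ⊗ₜ (Pi.single c x : ∀ j, A j) j := by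
  rw [splitLast, gbpLift_ap]; rfl

open Classical in
/-- The family indexed by the arrows starting at `i` whose component at `β` is `ε h` times `q` on
`A`-paths `h β q`, and zero on all other `A`-paths. -/
def splitArrow (i : V) (ε : A i →ₗ[k] k) (hi : ∀ ρ ∈ I, ρ.source ≠ i) :
    GBPAlgebra pres I →ₗ[k] ((Σ l, i ⟶ l) → GBPAlgebra pres I) :=
  gbpLift pres I
    (fun a _ p => p.consElim (fun _ => 0) (fun l h β q γ =>
      -- Arrows are compared together with their endpoints, since `a` is not known to be `i`.
      if (⟨a, l, β⟩ : Σ a l, a ⟶ l) = ⟨i, γ⟩ then ε ((Pi.single a h : ∀ j, A j) i) • ap pres I q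
      else 0))
    (fun a b p p₁ p₂ hp => by
      obtain ⟨x, y, rfl, rfl, rfl, rfl⟩ | ⟨l, h, h', β, q, rfl, rfl, rfl⟩ |
        ⟨l, h, β, q, q₁, q₂, hq, rfl, rfl, rfl⟩ := hp.exists_push
      · simp
      · ext γ
        simp only [APath.consElim_push, Pi.add_apply]
        split_ifs <;> simp [Pi.single_add, add_smul]
      · ext γ
        simp only [APath.consElim_push, Pi.add_apply]
        split_ifs <;> simp [ap_isSum pres I hq])
    (fun a b c p p₁ hp => by
      obtain ⟨x, rfl, rfl, rfl⟩ | ⟨l, h, β, q, rfl, rfl⟩ |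
        ⟨l, h, β, q, q₁, hq, rfl, rfl⟩ := hp.exists_push
      · simp
      · ext γ
        simp only [APath.consElim_push, Pi.smul_apply]
        split_ifs <;> simp [Pi.single_smul, mul_smul]
      · ext γ
        simp only [APath.consElim_push, Pi.smul_apply]
        split_ifs
        · rw [ap_isSMul pres I hq, smul_comm]
        · rw [smul_zero])
    (fun ρ hρ f hf a b s t => by
      ext γ
      rw [Finset.sum_apply]
      -- If `s` has length zero, the first arrow belongs to the relation, which does not start at
      -- `i`, so every term is zero. Otherwise the removed arrow belongs to `s` and the relation
      -- survives behind it.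
      obtain ⟨x, rfl, rfl⟩ | ⟨l, h, β, q, rfl⟩ := s.eq_nil_or_push
      · refine Finset.sum_eq_zero fun p hp => ?_
        obtain ⟨l, β, r, hr⟩ := (hf p hp).exists_push (ρ.length_ne_zero hp)
        rw [hr, APath.push_comp, APath.nil_comp_push, APath.consElim_push, Pi.smul_apply, if_neg,
          smul_zero]
        exact fun h => hi ρ hρ (congrArg Sigma.fst h)
      · refine Eq.trans (Finset.sum_congr rfl fun p hp => ?_) (sum_coeff_smul_ap_mul hρ hf
          ((if (⟨a, l, β⟩ : Σ a l, a ⟶ l) = ⟨i, γ⟩ then ε ((Pi.single a h : ∀ j, A j) i) else 0) •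
            LinearMap.id) (ap pres I q) (ap pres I t))
        rw [APath.push_comp, APath.consElim_push, Pi.smul_apply, mul_assoc, ap_mul, ap_mul]
        split_ifs <;> simp)

open Classical in
theorem splitArrow_push (i : V) (ε : A i →ₗ[k] k) (hi : ∀ ρ ∈ I, ρ.source ≠ i) {l b : V} (h : A i)
    (β : i ⟶ l) (q : APath A l b) :
    splitArrow pres I i ε hi (ap pres I (.push h β q)) = Pi.single ⟨l, β⟩ (ε h • ap pres I q) := by
  rw [splitArrow, gbpLift_ap, APath.consElim_push]
  ext γ
  by_cases hγ : γ = ⟨l, β⟩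
  · subst hγ
    simp
  · rw [Pi.single_eq_of_ne hγ, if_neg]
    intro h
    exact hγ (eq_of_heq (Sigma.mk.inj h).2).symm

end Split

/-! ### The right ideal generated by the arrows starting at a vertex -/

section ArrowIdeal

variable {k : Type u} [Field k] {V : Type v} [Quiver.{e} V] {A : V → Type w}
  [∀ i, Ring (A i)] [∀ i, Algebra k (A i)] (pres : ∀ i, BoundQuiverPresentation k (A i))
  [Fintype V] (I : Set (Relation k V))

/-- The class of an arrow. -/
def arrowElt {i l : V} (β : i ⟶ l) : GBPAlgebra pres I := ap pres I (APath.push 1 β (.nil 1))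

theorem arrowElt_mul_ap {i l b : V} (β : i ⟶ l) (q : APath A l b) :
    arrowElt pres I β * ap pres I q = ap pres I (.push 1 β q) := by
  rw [arrowElt, ap_mul, APath.push_comp, APath.one_comp]

theorem arrowElt_mul_ap_of_ne {i l a b : V} (h : l ≠ a) (β : i ⟶ l) (q : APath A a b) :
    arrowElt pres I β * ap pres I q = 0 :=
  ap_mul_of_ne pres I h _ _

theorem ofVertex_smul (j : V) (c : k) (a : A j) :
    ofVertex pres I j (c • a) = c • ofVertex pres I j a :=
  ap_isSMul pres I (.nil a)

theorem ap_mul_ofVertex_one {a b : V} (p : APath A a b) :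
    ap pres I p * ofVertex pres I b 1 = ap pres I p := by
  rw [ofVertex_eq, ap_mul, APath.comp_one]

theorem ofProd_mul_ap {a b : V} (x : ∀ j, A j) (p : APath A a b) :
    ofProd pres I x * ap pres I p = ap pres I ((APath.nil (x a)).comp p) := by
  rw [ofProd, Finset.sum_mul, Finset.sum_eq_single a, ofVertex_eq, ap_mul]
  · intro j _ hj
    rw [ofVertex_eq, ap_mul_of_ne pres I hj]
  · simp

theorem gbpProj_ofVertex (i : V) (x : A i) : gbpProj pres I i (ofVertex pres I i x) = x := by
  change pathLift k APath.entry (fun _ _ _ h => h.entry) (fun _ _ _ h => h.entry)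
    (GenPathAlgebra.single k (cls k (APath.nil x)) i i) = x
  rw [GenPathAlgebra.single_self, pathLift_cls]
  rfl

theorem gbpProj_ofVertex_of_ne {i j : V} (h : i ≠ j) (x : A j) :
    gbpProj pres I i (ofVertex pres I j x) = 0 := by
  change pathLift k APath.entry (fun _ _ _ h => h.entry) (fun _ _ _ h => h.entry)
    (GenPathAlgebra.single k (cls k (APath.nil x)) i i) = 0
  rw [GenPathAlgebra.single_ne_left k _ h, map_zero]

theorem gbpProj_ofProd (i : V) (x : ∀ j, A j) : gbpProj pres I i (ofProd pres I x) = x i := by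
  rw [ofProd, map_sum, Finset.sum_eq_single i, gbpProj_ofVertex]
  · intro j _ hj
    exact gbpProj_ofVertex_of_ne pres I hj.symm _
  · simp

theorem gbpProj_push (i : V) {a l b : V} (h : A a) (β : a ⟶ l) (q : APath A l b) :
    gbpProj pres I i (ap pres I (.push h β q)) = 0 := by
  cases q with
  | nil x => exact GenPathAlgebra.vertexProj_ofAPath_cons k i _ _ _
  | cons q γ x => exact GenPathAlgebra.vertexProj_ofAPath_cons k i _ _ _

theorem gbpProj_smul (i : V) (c : k) (y : GBPAlgebra pres I) :
    gbpProj pres I i (c • y) = c • gbpProj pres I i y := by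
  obtain ⟨y, rfl⟩ := Ideal.Quotient.mk_surjective y
  exact map_smul (GenPathAlgebra.vertexProj (A := A) k i) c y

/-- Left multiplication changes only the first entry, which `splitHead` puts in the second factor.
With `tensorAction_smul` this makes `coneSnd` balanced. -/
theorem splitHead_ofProd_mul (i : V) (x : ∀ j, A j) (y : GBPAlgebra pres I) :
    splitHead pres I i (ofProd pres I x * y) =
      TensorProduct.map LinearMap.id (LinearMap.mulLeft k (x i)) (splitHead pres I i y) := by
  classical
  induction y using gbp_induction with
  | zero => simp
  | add f g hf hg => rw [mul_add, map_add, map_add, hf, hg, map_add]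
  | smul c f hf => rw [mul_smul_comm, map_smul, map_smul, hf, map_smul]
  | ap a b p =>
    rw [ofProd_mul_ap]
    induction p using APath.push_cases with
    | nil h =>
      rw [splitHead_nil, map_zero]
      exact splitHead_nil pres I i _
    | push l b h β q =>
      rw [APath.nil_comp_push, splitHead_push, splitHead_push, TensorProduct.map_tmul]
      congr 1
      by_cases ha : i = a
      · subst ha
        simp
      · simp [Pi.single_eq_of_ne ha]

/-- The right ideal of the generalized bound path algebra generated by the arrows starting at `i`. -/
def arrowIdeal (i : V) : Submodule (GBPAlgebra pres I)ᵐᵒᵖ (GBPAlgebra pres I) :=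
  Submodule.span _ (Set.range fun s : Σ l, i ⟶ l => arrowElt pres I s.2)

instance (i : V) [∀ i j : V, Finite (i ⟶ j)] :
    Module.Finite (GBPAlgebra pres I)ᵐᵒᵖ (arrowIdeal pres I i) :=
  Module.Finite.span_of_finite _ (Set.finite_range _)

variable {pres I}

theorem arrowElt_mul_mem {i l : V} (β : i ⟶ l) (y : GBPAlgebra pres I) :
    arrowElt pres I β * y ∈ arrowIdeal pres I i :=
  Submodule.smul_mem _ (MulOpposite.op y) (Submodule.subset_span ⟨⟨l, β⟩, rfl⟩)

theorem push_mem_arrowIdeal {i l b : V} (β : i ⟶ l) (q : APath A l b) :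
    ap pres I (.push 1 β q) ∈ arrowIdeal pres I i :=
  arrowElt_mul_ap pres I β q ▸ arrowElt_mul_mem β _

theorem mul_mem_arrowIdeal {i : V} {d : GBPAlgebra pres I} (hd : d ∈ arrowIdeal pres I i)
    (y : GBPAlgebra pres I) : d * y ∈ arrowIdeal pres I i :=
  Submodule.smul_mem _ (MulOpposite.op y) hd

theorem smul_mem_arrowIdeal {i : V} {d : GBPAlgebra pres I} (hd : d ∈ arrowIdeal pres I i)
    (c : k) : c • d ∈ arrowIdeal pres I i := by
  have := mul_mem_arrowIdeal hd (c • 1)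
  rwa [mul_smul_comm, mul_one] at this

/-- As a space, the right ideal is spanned by the `A`-paths `1 β q`, because multiplying an arrow by
an `A`-path gives such a path or zero. -/
theorem arrowIdeal_induction {i : V} {motive : ∀ d, d ∈ arrowIdeal pres I i → Prop}
    (push : ∀ l b (β : i ⟶ l) (q : APath A l b), motive _ (push_mem_arrowIdeal β q))
    (zero : motive 0 (Submodule.zero_mem _))
    (add : ∀ f g hf hg, motive f hf → motive g hg → motive (f + g) (Submodule.add_mem _ hf hg))
    (smul : ∀ (c : k) f hf, motive f hf → motive (c • f) (smul_mem_arrowIdeal hf c))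
    {d : GBPAlgebra pres I} (hd : d ∈ arrowIdeal pres I i) : motive d hd := by
  -- Span induction over `Λ` has a case of multiplication by an arbitrary element, so the claim is
  -- strengthened to all right multiples.
  suffices ∀ y, ∃ h, motive (d * y) h by simpa [hd] using this 1
  induction hd using Submodule.span_induction with
  | mem d hd =>
    obtain ⟨⟨l, β⟩, rfl⟩ := hd
    intro y
    induction y using gbp_induction with
    | zero => rw [mul_zero]; exact ⟨_, zero⟩
    | add f g hf hg => rw [mul_add]; exact ⟨_, add _ _ _ _ hf.2 hg.2⟩
    | smul c f hf => rw [mul_smul_comm]; exact ⟨_, smul _ _ _ hf.2⟩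
    | ap a b q =>
      by_cases h : l = a
      · subst h
        rw [arrowElt_mul_ap]
        exact ⟨_, push _ _ _ _⟩
      · rw [arrowElt_mul_ap_of_ne pres I h]
        exact ⟨_, zero⟩
  | zero => intro y; rw [zero_mul]; exact ⟨_, zero⟩
  | add f g _ _ hf hg => intro y; rw [add_mul]; exact ⟨_, add _ _ _ _ (hf y).2 (hg y).2⟩
  | smul z f _ hf =>
    intro y
    change ∃ h, motive (f * z.unop * y) h
    rw [mul_assoc]
    exact hf _

/-- All spanning paths have first entry `1`. Hence `coneSnd` returns `d ⊗ n` on the class of `d ⊗ n`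
with `d` in the arrow ideal, and no such tensor is lost in the cone. -/
theorem splitHead_of_mem {i : V} {d : GBPAlgebra pres I} (hd : d ∈ arrowIdeal pres I i) :
    splitHead pres I i d = d ⊗ₜ 1 := by
  classical
  induction hd using arrowIdeal_induction with
  | push l b β q => rw [splitHead_push, Pi.single_eq_same]
  | zero => simp
  | add f g _ _ hf hg => rw [map_add, hf, hg, TensorProduct.add_tmul]
  | smul c f _ hf => rw [map_smul, hf, TensorProduct.smul_tmul']

theorem gbpProj_of_mem {i : V} {d : GBPAlgebra pres I} (hd : d ∈ arrowIdeal pres I i) :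
    gbpProj pres I i d = 0 := by
  induction hd using arrowIdeal_induction with
  | push l b β q => exact gbpProj_push pres I i _ _ _
  | zero => simp
  | add f g _ _ hf hg => rw [map_add, hf, hg, add_zero]
  | smul c f _ hf => rw [gbpProj_smul, hf, smul_zero]

/-- A path `1 β q` survives multiplication by `e_j` only if it ends at `j`. Then `β` followed by `q`
is a path of positive length from `i` to `j`, which acyclicity forbids for `j = i`. -/
theorem eq_zero_of_mem_arrowIdeal (hacyclic : ∀ (i : V) (p : Quiver.Path i i), p = Quiver.Path.nil)
    {i j : V} {d : GBPAlgebra pres I} (hd : d ∈ arrowIdeal pres I i)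
    (hj : ¬ (j ≠ i ∧ Nonempty (Quiver.Path i j))) : d * ofVertex pres I j 1 = 0 := by
  induction hd using arrowIdeal_induction with
  | push l b β q =>
    refine ap_mul_of_ne pres I (fun hb => hj ?_) _ _
    subst hb
    refine ⟨?_, (APath.push (1 : A i) β q).nonempty_path⟩
    rintro rfl
    obtain ⟨p⟩ := q.nonempty_path
    have h := congrArg Quiver.Path.length (hacyclic b (β.toPath.comp p))
    simp [Quiver.Path.length_comp] at h
  | zero => simp
  | add f g _ _ hf hg => rw [add_mul, hf, hg, add_zero]
  | smul c f _ hf => rw [smul_mul_assoc, hf, smul_zero]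

/-! ### Projectivity of the arrow ideal -/

theorem free_op_self (R : Type*) [Ring R] : Module.Free Rᵐᵒᵖ R :=
  let e : Rᵐᵒᵖ ≃ₗ[Rᵐᵒᵖ] R :=
    { (MulOpposite.opAddEquiv (α := R)).symm with map_smul' := fun _ _ => rfl }
  .of_equiv e

theorem exists_functional (R : Type*) [Ring R] [Algebra k R] :
    ∃ ε : R →ₗ[k] k, ε 1 = 1 ∨ Subsingleton R := by
  rcases subsingleton_or_nontrivial R with h | h
  · exact ⟨0, .inr h⟩
  · obtain ⟨ε, hε⟩ := Module.Projective.exists_dual_eq_one k (one_ne_zero (α := R))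
    exact ⟨ε, .inl hε⟩

/-- Right multiplication does not touch the first arrow once there is one. Outside the arrow ideal
this fails: an element of `A i` acquires a first arrow when multiplied by one. -/
theorem splitArrow_mul {i : V} (ε : A i →ₗ[k] k) (hi : ∀ ρ ∈ I, ρ.source ≠ i)
    {d : GBPAlgebra pres I} (hd : d ∈ arrowIdeal pres I i) (y : GBPAlgebra pres I) :
    splitArrow pres I i ε hi (d * y) = MulOpposite.op y • splitArrow pres I i ε hi d := by
  classical
  induction hd using arrowIdeal_induction with
  | zero => simp
  | add f g _ _ hf hg => rw [add_mul, map_add, map_add, hf, hg, smul_add]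
  | smul c f _ hf => rw [smul_mul_assoc, map_smul, map_smul, hf, smul_comm]
  | push l b β q =>
    induction y using gbp_induction with
    | zero => simp
    | add f g hf hg => rw [mul_add, map_add, hf, hg, MulOpposite.op_add, add_smul]
    | smul c f hf =>
      rw [mul_smul_comm, map_smul, hf]
      ext γ
      simp
    | ap a c r =>
      have hq : ∀ z, MulOpposite.op z • (Pi.single ⟨l, β⟩ (ε 1 • ap pres I q) :
          (Σ l, i ⟶ l) → GBPAlgebra pres I) = Pi.single ⟨l, β⟩ (ε 1 • (ap pres I q * z)) := by
        intro z
        rw [← Pi.single_smul, smul_comm]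
        rfl
      rw [splitArrow_push, hq]
      by_cases h : b = a
      · subst h
        rw [ap_mul, APath.push_comp, splitArrow_push, ap_mul]
      · rw [ap_mul_of_ne pres I h, ap_mul_of_ne pres I h, map_zero, smul_zero, Pi.single_zero]

/-- The ideal is a retract of a finite power of `Λ`: the map `s` multiplies the components by the
arrows and adds up, and `t` removes the first arrow. -/
theorem projective_arrowIdeal [∀ i j : V, Finite (i ⟶ j)] {i : V}
    (hi : ∀ ρ ∈ I, ρ.source ≠ i) :
    Module.Projective (GBPAlgebra pres I)ᵐᵒᵖ (arrowIdeal pres I i) := by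
  classical
  have := free_op_self (GBPAlgebra pres I)
  have := Fintype.ofFinite (Σ l, i ⟶ l)
  obtain ⟨ε, hε⟩ := exists_functional (k := k) (A i)
  let t : arrowIdeal pres I i →ₗ[(GBPAlgebra pres I)ᵐᵒᵖ] ((Σ l, i ⟶ l) → GBPAlgebra pres I) :=
    { toFun d := splitArrow pres I i ε hi d
      map_add' d d' := map_add _ _ _
      map_smul' y d := splitArrow_mul ε hi d.2 y.unop }
  let s : ((Σ l, i ⟶ l) → GBPAlgebra pres I) →ₗ[(GBPAlgebra pres I)ᵐᵒᵖ] arrowIdeal pres I i :=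
    { toFun f := ⟨∑ γ, arrowElt pres I γ.2 * f γ,
        Submodule.sum_mem _ fun γ _ => arrowElt_mul_mem _ _⟩
      map_add' f g := Subtype.ext <| by simp [mul_add, Finset.sum_add_distrib]
      map_smul' y f := Subtype.ext <| by
        simp only [Pi.smul_apply, MulOpposite.smul_eq_mul_unop, RingHom.id_apply,
          SetLike.val_smul, Finset.sum_mul, mul_assoc] }
  refine Module.Projective.of_split t s (LinearMap.ext fun d => Subtype.ext ?_)
  obtain ⟨d, hd⟩ := d
  change ∑ γ : Σ l, i ⟶ l, arrowElt pres I γ.2 * splitArrow pres I i ε hi d γ = d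
  induction hd using arrowIdeal_induction with
  | zero => simp
  | add f g _ _ hf hg => simp only [map_add, Pi.add_apply, mul_add, Finset.sum_add_distrib, hf, hg]
  | smul c f _ hf => simp only [map_smul, Pi.smul_apply, mul_smul_comm, ← Finset.smul_sum, hf]
  | push l b β q =>
    rw [splitArrow_push, Finset.sum_eq_single ⟨l, β⟩]
    · rw [Pi.single_eq_same, mul_smul_comm, arrowElt_mul_ap]
      obtain hε | hA := hε
      · rw [hε, one_smul]
      -- If `A i` is the zero ring there is no functional with `ε 1 = 1`, but then every path
      -- starting at `i` is zero in `Λ`.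
      · rw [APath.push_eq_comp, ← ap_mul, Subsingleton.elim (1 : A i) 0, ← ofVertex_eq, ofVertex_zero,
          zero_mul, smul_zero]
    · intro γ _ hγ
      rw [Pi.single_eq_of_ne hγ, mul_zero]
    · simp

end ArrowIdeal

/-! ### Freeness of the components -/

section Component

variable {k : Type u} [Field k] {V : Type v} [Quiver.{e} V] {A : V → Type w}
  [∀ i, Ring (A i)] [∀ i, Algebra k (A i)] {pres : ∀ i, BoundQuiverPresentation k (A i)}
  [Fintype V] {I : Set (Relation k V)}

variable (pres I) in
/-- The span of the `A`-paths of positive length from `i` to `j` with first and last entry `1`. -/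
def innerSpan (i j : V) : Submodule k (GBPAlgebra pres I) :=
  Submodule.span k {y | y ∈ arrowIdeal pres I i ∧
    ∃ b, ∃ p : APath A i b, ∃ β : b ⟶ j, y = ap pres I (.cons p β 1)}

theorem mem_arrowIdeal_of_mem_innerSpan {i j : V} {z : GBPAlgebra pres I}
    (hz : z ∈ innerSpan pres I i j) : z ∈ arrowIdeal pres I i := by
  induction hz using Submodule.span_induction with
  | mem z hz => exact hz.1
  | zero => exact Submodule.zero_mem _
  | add y z _ _ hy hz => exact Submodule.add_mem _ hy hz
  | smul c z _ hz => exact smul_mem_arrowIdeal hz c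

theorem mul_one_of_mem_innerSpan {i j : V} {z : GBPAlgebra pres I}
    (hz : z ∈ innerSpan pres I i j) : z * ofVertex pres I j 1 = z := by
  induction hz using Submodule.span_induction with
  | mem z hz =>
    obtain ⟨-, b, p, β, rfl⟩ := hz
    exact ap_mul_ofVertex_one pres I _
  | zero => exact zero_mul _
  | add y z _ _ hy hz => rw [add_mul, hy, hz]
  | smul c z _ hz => rw [smul_mul_assoc, hz]

/-- The last entry of `z` is `1`, so that of `z x` is `x` and can be read off. This is the
injectivity of `Z ⊗ A j → D e_j`. -/
theorem splitLast_mul_of_mem_innerSpan {i j : V} {z : GBPAlgebra pres I}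
    (hz : z ∈ innerSpan pres I i j) (x : A j) :
    splitLast pres I j (z * ofVertex pres I j x) = z ⊗ₜ x := by
  classical
  induction hz using Submodule.span_induction with
  | mem z hz =>
    obtain ⟨-, b, p, β, rfl⟩ := hz
    rw [ofVertex_eq, ap_mul]
    simp only [APath.comp, APath.rmul, one_mul]
    rw [splitLast_cons, Pi.single_eq_same]
  | zero => simp
  | add y z _ _ hy hz => rw [add_mul, map_add, hy, hz, TensorProduct.add_tmul]
  | smul c z _ hz => rw [smul_mul_assoc, map_smul, hz, TensorProduct.smul_tmul']

theorem exists_push_mul_ofVertex {i j l b : V} (β : i ⟶ l) (q : APath A l b) :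
    ∃ z ∈ innerSpan pres I i j, ∃ x,
      ap pres I (.push 1 β q) * ofVertex pres I j 1 = z * ofVertex pres I j x := by
  by_cases h : b = j
  · subst h
    rw [ap_mul_ofVertex_one]
    cases q with
    | nil x =>
      refine ⟨ap pres I (.push 1 β (.nil 1)), Submodule.subset_span
        ⟨push_mem_arrowIdeal _ _, _, _, β, rfl⟩, x, ?_⟩
      rw [ofVertex_eq, ap_mul, APath.push_comp, APath.one_comp]
    | cons q γ x =>
      refine ⟨ap pres I (.push 1 β (.cons q γ 1)), Submodule.subset_span
        ⟨push_mem_arrowIdeal _ _, _, _, γ, rfl⟩, x, ?_⟩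
      rw [ofVertex_eq, ap_mul, APath.push_comp]
      simp only [APath.comp, APath.rmul, one_mul]
  · exact ⟨0, Submodule.zero_mem _, 0, by rw [ofVertex_eq, ap_mul_of_ne pres I h, zero_mul]⟩

/-- An element of `innerSpan` as an element of the component of the arrow ideal. -/
def innerToComponent {i j : V} (z : innerSpan pres I i j) :
    component pres I (arrowIdeal pres I i) j :=
  ⟨⟨z, mem_arrowIdeal_of_mem_innerSpan z.2⟩, Subtype.ext (mul_one_of_mem_innerSpan z.2)⟩

/-- The inclusion of a component of the arrow ideal into the algebra. -/
def componentVal {i j : V} : component pres I (arrowIdeal pres I i) j →+ GBPAlgebra pres I :=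
  (arrowIdeal pres I i).subtype.toAddMonoidHom.comp (AddSubgroup.subtype _)

theorem componentVal_smul {i j : V} (x : (A j)ᵐᵒᵖ)
    (y : component pres I (arrowIdeal pres I i) j) :
    componentVal (x • y) = componentVal y * ofVertex pres I j x.unop := rfl

theorem componentVal_mul_one {i j : V} (y : component pres I (arrowIdeal pres I i) j) :
    componentVal y * ofVertex pres I j 1 = componentVal y :=
  congrArg Subtype.val y.2

theorem componentVal_injective {i j : V} :
    Function.Injective (componentVal (pres := pres) (I := I) (i := i) (j := j)) :=
  fun _ _ h => Subtype.ext (Subtype.ext h)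

theorem sum_basis_tmul_eq_zero {W X : Type*} [AddCommGroup W] [Module k W] [AddCommGroup X]
    [Module k X] {Z : Submodule k W} {ι : Type*} (b : Module.Basis ι k Z) (c : ι →₀ X)
    (h : ∑ s ∈ c.support, (b s : W) ⊗ₜ[k] c s = 0) : c = 0 := by
  classical
  refine TensorProduct.sum_tmul_basis_left_eq_zero b c ?_
  apply Module.Flat.rTensor_preserves_injective_linearMap (M := X) Z.subtype Subtype.val_injective
  rw [map_zero, Finsupp.sum, map_sum]
  exact h

/-- The map `φ` turns a vanishing `R`-combination of the `v s` into a vanishing sum of `b s ⊗ c s`,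
whose coefficients are zero since the `b s` are independent over `k`. Additivity of `φ` is enough.
-/
theorem linearIndependent_of_tmul {R N W : Type*} [Ring R] [Algebra k R] [AddCommGroup N]
    [Module Rᵐᵒᵖ N] [AddCommGroup W] [Module k W] {Z : Submodule k W} {ι : Type*}
    (b : Module.Basis ι k Z) {v : ι → N} (φ : N →+ W ⊗[k] R)
    (h : ∀ s (x : Rᵐᵒᵖ), φ (x • v s) = (b s : W) ⊗ₜ x.unop) : LinearIndependent Rᵐᵒᵖ v := by
  classical
  rw [linearIndependent_iff]
  intro c hc
  have h1 : ∑ s ∈ c.support, (b s : W) ⊗ₜ[k] (c s).unop = 0 := by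
    simpa [Finsupp.linearCombination_apply, Finsupp.sum, h] using congrArg φ hc
  have h2 := sum_basis_tmul_eq_zero b (c.mapRange MulOpposite.unop rfl) <| by
    rwa [Finsupp.support_mapRange_of_injective _ _ MulOpposite.unop_injective]
  ext s
  exact MulOpposite.unop_injective (DFunLike.congr_fun h2 s)

theorem exists_mem_span_of_mem_innerSpan {i j : V} {ι : Type*}
    (b : Module.Basis ι k (innerSpan pres I i j)) {z : GBPAlgebra pres I}
    (hz : z ∈ innerSpan pres I i j) (x : A j) :
    ∃ y ∈ Submodule.span (A j)ᵐᵒᵖ (Set.range fun s => innerToComponent (b s)),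
      componentVal y = z * ofVertex pres I j x := by
  -- Expanding `z = ∑ c_s b_s` gives `z x = ∑ b_s (c_s x)`: the scalars of `k` are absorbed into the
  -- coefficient in `A j`.
  refine ⟨((b.repr ⟨z, hz⟩).mapRange (fun c => MulOpposite.op (c • x)) (by simp)).sum
    fun s a => a • innerToComponent (b s), Submodule.sum_mem _ fun s _ => Submodule.smul_mem _ _
      (Submodule.subset_span ⟨s, rfl⟩), ?_⟩
  rw [Finsupp.sum_mapRange_index (by simp), Finsupp.sum, map_sum]
  have h := congrArg Subtype.val (b.linearCombination_repr ⟨z, hz⟩)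
  rw [Finsupp.linearCombination_apply, Finsupp.sum, Submodule.coe_sum] at h
  change _ = z at h
  conv_rhs => rw [← h, Finset.sum_mul]
  refine Finset.sum_congr rfl fun s _ => ?_
  rw [componentVal_smul, MulOpposite.unop_op, ofVertex_smul, mul_smul_comm, Submodule.coe_smul,
    smul_mul_assoc]
  rfl

theorem exists_mem_span_of_mem_arrowIdeal {i j : V} {ι : Type*}
    (b : Module.Basis ι k (innerSpan pres I i j)) {d : GBPAlgebra pres I}
    (hd : d ∈ arrowIdeal pres I i) :
    ∃ y ∈ Submodule.span (A j)ᵐᵒᵖ (Set.range fun s => innerToComponent (b s)),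
      componentVal y = d * ofVertex pres I j 1 := by
  induction hd using arrowIdeal_induction with
  | push l b' β q =>
    obtain ⟨z, hz, x, h⟩ := exists_push_mul_ofVertex (pres := pres) (I := I) (j := j) β q
    rw [h]
    exact exists_mem_span_of_mem_innerSpan b hz x
  | zero => exact ⟨0, Submodule.zero_mem _, by rw [map_zero, zero_mul]⟩
  | add f g _ _ hf hg =>
    obtain ⟨y, hy, hf⟩ := hf
    obtain ⟨y', hy', hg⟩ := hg
    exact ⟨y + y', Submodule.add_mem _ hy hy', by rw [map_add, hf, hg, add_mul]⟩
  | smul c f _ hf =>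
    obtain ⟨y, hy, hf⟩ := hf
    refine ⟨MulOpposite.op (c • 1 : A j) • y, Submodule.smul_mem _ _ hy, ?_⟩
    rw [componentVal_smul, MulOpposite.unop_op, ofVertex_smul, mul_smul_comm,
      componentVal_mul_one, hf, smul_mul_assoc]

/-- Any `k`-basis of `innerSpan` is an `A j`-basis: independent by `splitLast`, and generating
because every spanning path ending at `j` is an inner one times its last entry. -/
theorem free_component_arrowIdeal (i j : V) :
    Module.Free (A j)ᵐᵒᵖ (component pres I (arrowIdeal pres I i) j) := by
  classical
  let b := Module.Basis.ofVectorSpace k (innerSpan pres I i j)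
  let v s : component pres I (arrowIdeal pres I i) j := innerToComponent (b s)
  have hli : LinearIndependent (A j)ᵐᵒᵖ v :=
    linearIndependent_of_tmul b ((splitLast pres I j).toAddMonoidHom.comp componentVal)
      fun s x => splitLast_mul_of_mem_innerSpan (b s).2 x.unop
  have hsp : ⊤ ≤ Submodule.span (A j)ᵐᵒᵖ (Set.range v) := by
    intro y _
    obtain ⟨y', hy', h⟩ := exists_mem_span_of_mem_arrowIdeal b (j := j) y.1.2
    change _ = componentVal y * _ at h
    rw [componentVal_mul_one] at h
    exact componentVal_injective h ▸ hy'
  exact Module.Free.of_basis (Module.Basis.mk hli hsp)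

/-- Components of a power of a module. -/
def componentPiEquiv (ι : Type*) (N : Type*) [AddCommGroup N] [Module (GBPAlgebra pres I)ᵐᵒᵖ N]
    (j : V) : component pres I (ι → N) j ≃ₗ[(A j)ᵐᵒᵖ] (ι → component pres I N j) where
  toFun y s := ⟨y.1 s, congrFun y.2 s⟩
  invFun y := ⟨fun s => y s, funext fun s => (y s).2⟩
  map_add' _ _ := rfl
  map_smul' _ _ := rfl

theorem free_component_pi {ι : Type*} [Finite ι] {N : Type*} [AddCommGroup N]
    [Module (GBPAlgebra pres I)ᵐᵒᵖ N] {j : V} (h : Module.Free (A j)ᵐᵒᵖ (component pres I N j)) :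
    Module.Free (A j)ᵐᵒᵖ (component pres I (ι → N) j) :=
  .of_equiv (componentPiEquiv (pres := pres) (I := I) ι N j).symm

theorem mem_support_pi {ι : Type*} {i j : V}
    (hacyclic : ∀ (i : V) (p : Quiver.Path i i), p = Quiver.Path.nil)
    (hj : j ∈ support pres I (ι → arrowIdeal pres I i)) : j ≠ i ∧ Nonempty (Quiver.Path i j) := by
  by_contra h
  refine hj ((AddSubgroup.eq_bot_iff_forall _).2 fun y hy => funext fun s => Subtype.ext ?_)
  have h1 : (y s : GBPAlgebra pres I) * ofVertex pres I j 1 = y s :=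
    congrArg Subtype.val (congrFun hy s)
  rw [← h1]
  exact eq_zero_of_mem_arrowIdeal hacyclic (y s).2 h

end Component

/-! ### Right modules over an algebra -/

section Action

variable {k R W N : Type*} [Field k] [Ring R] [Algebra k R] [AddCommGroup W] [Module k W]
  [AddCommGroup N] [Module k N] [Module Rᵐᵒᵖ N] [IsScalarTower k Rᵐᵒᵖ N]

variable (k R N) in
/-- The action of an algebra on a right module. -/
def actionMap : R ⊗[k] N →ₗ[k] N :=
  TensorProduct.lift <| LinearMap.mk₂ k (fun x n => MulOpposite.op x • n)
    (fun _ _ _ => by rw [MulOpposite.op_add, add_smul])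
    (fun _ _ _ => by rw [MulOpposite.op_smul, smul_assoc])
    (fun _ _ _ => smul_add _ _ _)
    (fun _ _ _ => smul_comm _ _ _)

variable (k R W N) in
/-- The map `(w ⊗ x) ⊗ n ↦ w ⊗ n x`. -/
def tensorAction : (W ⊗[k] R) ⊗[k] N →ₗ[k] W ⊗[k] N :=
  (actionMap k R N).lTensor W ∘ₗ (TensorProduct.assoc k W R N).toLinearMap

theorem tensorAction_tmul (w : W) (x : R) (n : N) :
    tensorAction k R W N ((w ⊗ₜ x) ⊗ₜ n) = w ⊗ₜ (MulOpposite.op x • n) := rfl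

theorem tensorAction_smul (t : W ⊗[k] R) (x : R) (n : N) :
    tensorAction k R W N (t ⊗ₜ (MulOpposite.op x • n)) =
      tensorAction k R W N
        (TensorProduct.map LinearMap.id (LinearMap.mulLeft k x) t ⊗ₜ n) := by
  induction t using TensorProduct.induction_on with
  | zero => simp
  | add f g hf hg => simp only [TensorProduct.add_tmul, map_add, hf, hg]
  | tmul w y =>
    rw [TensorProduct.map_tmul, tensorAction_tmul, tensorAction_tmul, smul_smul,
      ← MulOpposite.op_mul]
    rfl

end Action

/-! ### Cones -/

section Cone

variable {k : Type u} [Field k] {V : Type v} [Quiver.{e} V] {A : V → Type w}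
  [∀ i, Ring (A i)] [∀ i, Algebra k (A i)] (pres : ∀ i, BoundQuiverPresentation k (A i))
  [Fintype V] (I : Set (Relation k V)) (i : V)
  (N : Type x) [AddCommGroup N] [Module k N] [Module (A i)ᵐᵒᵖ N]

/-- The class of a tensor in the cone. -/
def coneMk : GBPAlgebra pres I ⊗[k] N →+ Cone pres I i N :=
  (coneRel pres I i N).mkQ.toAddMonoidHom

theorem coneMk_surjective : Function.Surjective (coneMk pres I i N) :=
  Submodule.mkQ_surjective _

variable {N}

theorem coneMk_ofProd_mul (a : ∀ j, A j) (y : GBPAlgebra pres I) (n : N) :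
    coneMk pres I i N ((ofProd pres I a * y) ⊗ₜ n) =
      coneMk pres I i N (y ⊗ₜ (MulOpposite.op (a i) • n)) := by
  have h : y ⊗ₜ[k] (MulOpposite.op (a i) • n) - (ofProd pres I a * y) ⊗ₜ[k] n ∈
      coneRel pres I i N := Submodule.subset_span ⟨n, a, y, rfl⟩
  exact ((Submodule.Quotient.eq _).2 h).symm

/-- The additive map out of a cone given by a linear map that is balanced over `∏ j, A j`. -/
def coneLift {X : Type*} [AddCommGroup X] (φ : GBPAlgebra pres I ⊗[k] N →+ X)
    (hφ : ∀ (n : N) (a : ∀ j, A j) (y : GBPAlgebra pres I),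
      φ (y ⊗ₜ (MulOpposite.op (a i) • n)) = φ ((ofProd pres I a * y) ⊗ₜ n)) :
    Cone pres I i N →+ X :=
  QuotientAddGroup.lift (coneRel pres I i N).toAddSubgroup φ <| by
    intro z hz
    replace hz : z ∈ coneRel pres I i N := hz
    -- The relations of the cone generate a `Λ`-submodule, while `φ` is only additive, so vanishing
    -- is proved for all multiples of `z`.
    suffices ∀ r : (GBPAlgebra pres I)ᵐᵒᵖ, φ (r • z) = 0 by simpa using this 1
    induction hz using Submodule.span_induction with
    | mem z hz =>
      obtain ⟨n, a, y, rfl⟩ := hz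
      intro r
      rw [smul_sub, map_sub, sub_eq_zero, TensorProduct.smul_tmul', TensorProduct.smul_tmul', hφ,
        MulOpposite.smul_eq_mul_unop, MulOpposite.smul_eq_mul_unop, mul_assoc]
    | zero => intro r; rw [smul_zero, map_zero]
    | add y z _ _ hy hz => intro r; rw [smul_add, map_add, hy, hz, add_zero]
    | smul s z _ hz => intro r; rw [smul_smul]; exact hz _

-- The first entry of an `A`-path starting at `i` can be moved across the tensor sign onto the
-- module, leaving `e_i` or a path `1 β q`. This is the decomposition of the cone as `N + D ⊗ N`.
@[elab_as_elim]
theorem cone_induction {motive : Cone pres I i N → Prop}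
    (vertex : ∀ n, motive (coneMk pres I i N (ofVertex pres I i 1 ⊗ₜ n)))
    (arrow : ∀ d ∈ arrowIdeal pres I i, ∀ n, motive (coneMk pres I i N (d ⊗ₜ n)))
    (add : ∀ y z, motive y → motive z → motive (y + z)) (z : Cone pres I i N) : motive z := by
  classical
  have zero : motive 0 := by simpa using vertex 0
  obtain ⟨z, rfl⟩ := coneMk_surjective pres I i N z
  induction z using TensorProduct.induction_on with
  | zero => rwa [map_zero]
  | add y z hy hz => rw [map_add]; exact add _ _ hy hz
  | tmul y n =>
    induction y using gbp_induction generalizing n with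
    | zero => rwa [TensorProduct.zero_tmul, map_zero]
    | add f g hf hg => rw [TensorProduct.add_tmul, map_add]; exact add _ _ (hf n) (hg n)
    | smul c f hf => rw [TensorProduct.smul_tmul]; exact hf _
    | ap a b p =>
      by_cases ha : a = i
      · subst ha
        induction p using APath.push_cases with
        | nil x =>
          have h := ofProd_mul_ap pres I (Pi.single a x) (APath.nil (1 : A a))
          rw [Pi.single_eq_same, APath.comp_one] at h
          rw [← h, coneMk_ofProd_mul]
          exact vertex _
        | push l b x β q =>
          have h := ofProd_mul_ap pres I (Pi.single a x) (APath.push (1 : A a) β q)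
          rw [Pi.single_eq_same, APath.nil_comp_push, mul_one] at h
          rw [← h, coneMk_ofProd_mul]
          exact arrow _ (push_mem_arrowIdeal β q) _
      -- A path starting at `a ≠ i` equals `e_a` times itself, and `e_a` acts as zero on `N`.
      · have h := ofProd_mul_ap pres I (Pi.single a 1) p
        rw [Pi.single_eq_same, APath.one_comp] at h
        rw [← h, coneMk_ofProd_mul, Pi.single_eq_of_ne (Ne.symm ha), MulOpposite.op_zero, zero_smul,
          TensorProduct.tmul_zero, map_zero]
        exact zero

/-- The additive map from the arrow ideal to the cone given by an element of the module. -/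
def arrowToCone (n : N) :
    arrowIdeal pres I i →ₗ[(GBPAlgebra pres I)ᵐᵒᵖ] Cone pres I i N where
  toFun d := coneMk pres I i N ((d : GBPAlgebra pres I) ⊗ₜ n)
  map_add' d d' := by rw [Submodule.coe_add, TensorProduct.add_tmul, map_add]
  map_smul' _ _ := rfl

/-! ### The two coordinates of a cone: `N` and `D ⊗ N`. -/

variable [IsScalarTower k (A i)ᵐᵒᵖ N]

/-- The projection of `k(V, A, I)` onto `A i` as a linear map. -/
def gbpProjLinear : GBPAlgebra pres I →ₗ[k] A i where
  __ := gbpProj pres I i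
  map_smul' := gbpProj_smul pres I i

/-- The component at `i` of the cone over an `A i`-module. -/
def coneFst : Cone pres I i N →+ N :=
  coneLift pres I i
    (actionMap k (A i) N ∘ₗ (gbpProjLinear pres I i).rTensor N).toAddMonoidHom fun n a y => by
    change MulOpposite.op (gbpProj pres I i y) • MulOpposite.op (a i) • n =
      MulOpposite.op (gbpProj pres I i (ofProd pres I a * y)) • n
    rw [map_mul, gbpProj_ofProd, MulOpposite.op_mul, mul_smul]

theorem coneFst_mk (y : GBPAlgebra pres I) (n : N) :
    coneFst pres I i (coneMk pres I i N (y ⊗ₜ n)) = MulOpposite.op (gbpProj pres I i y) • n := rfl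

/-- The part of the cone over an `A i`-module away from the vertex `i`, as a space. -/
def coneSnd : Cone pres I i N →+ GBPAlgebra pres I ⊗[k] N :=
  coneLift pres I i
    (tensorAction k (A i) (GBPAlgebra pres I) N ∘ₗ
      (splitHead pres I i).rTensor N).toAddMonoidHom fun n a y => by
    change tensorAction k (A i) (GBPAlgebra pres I) N (splitHead pres I i y ⊗ₜ (MulOpposite.op (a i) • n)) =
      tensorAction k (A i) (GBPAlgebra pres I) N (splitHead pres I i (ofProd pres I a * y) ⊗ₜ n)
    rw [splitHead_ofProd_mul, tensorAction_smul]

theorem coneSnd_mk (y : GBPAlgebra pres I) (n : N) :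
    coneSnd pres I i (coneMk pres I i N (y ⊗ₜ n)) =
      tensorAction k (A i) (GBPAlgebra pres I) N (splitHead pres I i y ⊗ₜ n) := rfl

theorem coneSnd_arrow {d : GBPAlgebra pres I} (hd : d ∈ arrowIdeal pres I i) (n : N) :
    coneSnd pres I i (coneMk pres I i N (d ⊗ₜ n)) = d ⊗ₜ n := by
  rw [coneSnd_mk, splitHead_of_mem hd, tensorAction_tmul, MulOpposite.op_one, one_smul]

theorem coneSnd_vertex (n : N) :
    coneSnd pres I i (coneMk pres I i N (ofVertex pres I i 1 ⊗ₜ n)) = 0 := by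
  rw [coneSnd_mk, ofVertex_eq, splitHead_nil, TensorProduct.zero_tmul, map_zero]

theorem coneFst_vertex (n : N) :
    coneFst pres I i (coneMk pres I i N (ofVertex pres I i 1 ⊗ₜ n)) = n := by
  rw [coneFst_mk, gbpProj_ofVertex, MulOpposite.op_one, one_smul]

theorem coneFst_arrow {d : GBPAlgebra pres I} (hd : d ∈ arrowIdeal pres I i) (n : N) :
    coneFst pres I i (coneMk pres I i N (d ⊗ₜ n)) = 0 := by
  rw [coneFst_mk, gbpProj_of_mem hd, MulOpposite.op_zero, zero_smul]

theorem coneFst_smul (r : (GBPAlgebra pres I)ᵐᵒᵖ) (z : Cone pres I i N) :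
    coneFst pres I i (r • z) = MulOpposite.op (gbpProj pres I i r.unop) • coneFst pres I i z := by
  obtain ⟨z, rfl⟩ := coneMk_surjective pres I i N z
  change coneFst pres I i (coneMk pres I i N (r • z)) = _
  induction z using TensorProduct.induction_on with
  | zero => rw [smul_zero, map_zero, map_zero, smul_zero]
  | add y z hy hz => rw [smul_add, map_add, map_add, hy, hz, map_add, map_add, smul_add]
  | tmul y n =>
    rw [TensorProduct.smul_tmul', coneFst_mk, coneFst_mk, smul_smul, ← MulOpposite.op_mul, ← map_mul]
    rfl

/-- Recovers an element from its coordinates, so that injectivity of a map between cones can be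
tested on `coneFst` and `coneSnd`. -/
theorem cone_eq_add (z : Cone pres I i N) :
    z = coneMk pres I i N (ofVertex pres I i 1 ⊗ₜ coneFst pres I i z) +
      coneMk pres I i N (coneSnd pres I i z) := by
  induction z using cone_induction with
  | vertex n => rw [coneFst_vertex, coneSnd_vertex, map_zero, add_zero]
  | arrow d hd n =>
    rw [coneFst_arrow _ _ _ hd, coneSnd_arrow _ _ _ hd, TensorProduct.tmul_zero, map_zero, zero_add]
  | add y z hy hz =>
    rw [map_add, map_add, TensorProduct.tmul_add, map_add, map_add, add_add_add_comm, ← hy, ← hz]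

/-! ### Functoriality of cones. -/

variable {i} {N' : Type y} [AddCommGroup N'] [Module k N'] [Module (A i)ᵐᵒᵖ N']
  [IsScalarTower k (A i)ᵐᵒᵖ N']

/-- The map of cones induced by a map of modules. -/
def coneMap (g : N →ₗ[(A i)ᵐᵒᵖ] N') :
    Cone pres I i N →ₗ[(GBPAlgebra pres I)ᵐᵒᵖ] Cone pres I i N' where
  __ := coneLift pres I i ((coneMk pres I i N').comp
    ((g.restrictScalars k).lTensor (GBPAlgebra pres I)).toAddMonoidHom) fun n a y => by
      change coneMk pres I i N' (y ⊗ₜ g (MulOpposite.op (a i) • n)) =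
        coneMk pres I i N' ((ofProd pres I a * y) ⊗ₜ g n)
      rw [map_smul, coneMk_ofProd_mul]
  map_smul' r z := by
    obtain ⟨z, rfl⟩ := coneMk_surjective pres I i N z
    change coneMk pres I i N' ((g.restrictScalars k).lTensor (GBPAlgebra pres I) (r • z)) =
      coneMk pres I i N' (r • (g.restrictScalars k).lTensor (GBPAlgebra pres I) z)
    congr 1
    induction z using TensorProduct.induction_on with
    | zero => simp only [smul_zero, map_zero]
    | add y z hy hz => rw [smul_add, map_add, map_add, hy, hz, smul_add]
    | tmul y n => rfl

theorem coneMap_mk (g : N →ₗ[(A i)ᵐᵒᵖ] N') (y : GBPAlgebra pres I) (n : N) :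
    coneMap pres I g (coneMk pres I i N (y ⊗ₜ n)) = coneMk pres I i N' (y ⊗ₜ g n) := rfl

theorem coneFst_coneMap (g : N →ₗ[(A i)ᵐᵒᵖ] N') (z : Cone pres I i N) :
    coneFst pres I i (coneMap pres I g z) = g (coneFst pres I i z) := by
  induction z using cone_induction with
  | vertex n => rw [coneMap_mk, coneFst_vertex, coneFst_vertex]
  | arrow d hd n => rw [coneMap_mk, coneFst_arrow _ _ _ hd, coneFst_arrow _ _ _ hd, map_zero]
  | add y z hy hz => rw [map_add, map_add, hy, hz, map_add, map_add]

theorem coneSnd_coneMap (g : N →ₗ[(A i)ᵐᵒᵖ] N') (z : Cone pres I i N) :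
    coneSnd pres I i (coneMap pres I g z) =
      (g.restrictScalars k).lTensor (GBPAlgebra pres I) (coneSnd pres I i z) := by
  induction z using cone_induction with
  | vertex n => rw [coneMap_mk, coneSnd_vertex, coneSnd_vertex, map_zero]
  | arrow d hd n => rw [coneMap_mk, coneSnd_arrow _ _ _ hd, coneSnd_arrow _ _ _ hd]; rfl
  | add y z hy hz => rw [map_add, map_add, hy, hz, map_add, map_add]

end Cone

/-! ### Tensor products over a field -/

section Field

variable {k : Type*} [Field k] {ι : Type*} [Fintype ι]

theorem eq_zero_of_sum_tmul_basis {W X : Type*} [AddCommGroup W] [Module k W]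
    [AddCommGroup X] [Module k X] (b : Module.Basis ι k X) (l : ι → W)
    (h : ∑ s, l s ⊗ₜ[k] b s = 0) : l = 0 := by
  classical
  have h1 := TensorProduct.sum_tmul_basis_right_eq_zero b (Finsupp.equivFunOnFinite.symm l) <| by
    rwa [Finsupp.sum_fintype _ _ (by simp)]
  exact congrArg DFunLike.coe h1

/-- Applying `g` kills the part from `K` and leaves `∑ l s ⊗ b s`, so `l = 0`; then `t = 0` because
tensoring over a field preserves the injectivity of `j`. -/
theorem eq_zero_of_lTensor_add {W K P M : Type*} [AddCommGroup W] [Module k W]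
    [AddCommGroup K] [Module k K] [AddCommGroup P] [Module k P] [AddCommGroup M] [Module k M]
    {j : K →ₗ[k] P} (hj : Function.Injective j) {g : P →ₗ[k] M} (hgj : g ∘ₗ j = 0)
    (b : Module.Basis ι k M) {q : ι → P} (hq : ∀ s, g (q s) = b s) {t : W ⊗[k] K} {l : ι → W}
    (h : j.lTensor W t + ∑ s, l s ⊗ₜ q s = 0) : t = 0 ∧ l = 0 := by
  have hl : l = 0 := by
    refine eq_zero_of_sum_tmul_basis b l ?_
    have := congrArg (g.lTensor W) h
    rw [map_add, ← LinearMap.comp_apply, ← LinearMap.lTensor_comp, hgj, LinearMap.lTensor_zero,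
      LinearMap.zero_apply, zero_add, map_sum, map_zero] at this
    simpa [hq] using this
  subst hl
  refine ⟨Module.Flat.lTensor_preserves_injective_linearMap j hj ?_, rfl⟩
  simpa using h

end Field

/-! ### The exact sequence -/

section Exact

variable {k : Type u} [Field k] {V : Type v} [Quiver.{e} V] {A : V → Type w}
  [∀ i, Ring (A i)] [∀ i, Algebra k (A i)] (pres : ∀ i, BoundQuiverPresentation k (A i))
  [Fintype V] (I : Set (Relation k V)) {i : V}
  {M : Type x} [AddCommGroup M] [Module (A i)ᵐᵒᵖ M]
  {P : Type y} [AddCommGroup P] [Module k P] [Module (A i)ᵐᵒᵖ P] [IsScalarTower k (A i)ᵐᵒᵖ P]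
  (g : P →ₗ[(A i)ᵐᵒᵖ] M)

/-- The map from the cone over `P` to `M` induced by a map `P → M`. -/
def coneToTop : Cone pres I i P →ₗ[(GBPAlgebra pres I)ᵐᵒᵖ] NaturalInclusion pres I i M where
  toFun z := g (coneFst pres I i z)
  map_add' y z := by rw [map_add, map_add]; rfl
  map_smul' r z := by rw [coneFst_smul, map_smul]; rfl

theorem coneToTop_apply (z : Cone pres I i P) :
    coneToTop pres I g z = g (coneFst pres I i z) := rfl

theorem coneToTop_surjective (hg : Function.Surjective g) :
    Function.Surjective (coneToTop pres I g) := by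
  intro m
  obtain ⟨p, hp⟩ := hg m
  exact ⟨coneMk pres I i P (ofVertex pres I i 1 ⊗ₜ p), by
    rw [coneToTop_apply, coneFst_vertex, hp]⟩

variable {ι : Type*} [Fintype ι] (q : ι → P)

/-- The map into the cone over `P` given by the cone over the kernel of `P → M` and by
copies of the arrow ideal. -/
def kernelMap : (Cone pres I i (LinearMap.ker g) × (ι → arrowIdeal pres I i))
    →ₗ[(GBPAlgebra pres I)ᵐᵒᵖ] Cone pres I i P :=
  LinearMap.coprod (coneMap pres I (LinearMap.ker g).subtype)
    (∑ s, arrowToCone pres I i (q s) ∘ₗ LinearMap.proj s)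

theorem kernelMap_apply (c : Cone pres I i (LinearMap.ker g)) (l : ι → arrowIdeal pres I i) :
    kernelMap pres I g q (c, l) = coneMap pres I (LinearMap.ker g).subtype c +
      ∑ s, coneMk pres I i P ((l s : GBPAlgebra pres I) ⊗ₜ q s) := by
  rw [kernelMap, LinearMap.coprod_apply, LinearMap.sum_apply]
  rfl

theorem coneFst_kernelMap (c : Cone pres I i (LinearMap.ker g)) (l : ι → arrowIdeal pres I i) :
    coneFst pres I i (kernelMap pres I g q (c, l)) = coneFst pres I i c := by
  rw [kernelMap_apply, map_add, coneFst_coneMap, map_sum,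
    Finset.sum_eq_zero fun s _ => coneFst_arrow pres I i (l s).2 (q s), add_zero]
  rfl

theorem coneSnd_kernelMap (c : Cone pres I i (LinearMap.ker g)) (l : ι → arrowIdeal pres I i) :
    coneSnd pres I i (kernelMap pres I g q (c, l)) =
      ((LinearMap.ker g).subtype.restrictScalars k).lTensor (GBPAlgebra pres I)
        (coneSnd pres I i c) + ∑ s, (l s : GBPAlgebra pres I) ⊗ₜ q s := by
  rw [kernelMap_apply, map_add, coneSnd_coneMap, map_sum,
    Finset.sum_congr rfl fun s _ => coneSnd_arrow pres I i (l s).2 (q s)]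

variable [Module k M] [IsScalarTower k (A i)ᵐᵒᵖ M]

/-- The first coordinate sees only the vertex part of `c`. The second places the rest of `c` in `Λ ⊗
Ker g` and `l` along the lifts `q s`, which are independent modulo `Ker g`. -/
theorem kernelMap_injective (b : Module.Basis ι k M) (hq : ∀ s, g (q s) = b s) :
    Function.Injective (kernelMap pres I g q) := by
  rw [injective_iff_map_eq_zero]
  rintro ⟨c, l⟩ h
  have h1 : coneFst pres I i c = 0 := by
    have := coneFst_kernelMap pres I g q c l
    rw [h, map_zero] at this
    exact Subtype.ext this.symm
  have h2 := coneSnd_kernelMap pres I g q c l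
  rw [h, map_zero] at h2
  obtain ⟨h3, h4⟩ := eq_zero_of_lTensor_add (W := GBPAlgebra pres I)
    (j := (LinearMap.ker g).subtype.restrictScalars k) Subtype.val_injective
    (g := g.restrictScalars k) (LinearMap.ext fun p => p.2) b hq
    (l := fun s => (l s : GBPAlgebra pres I)) h2.symm
  have h5 : c = 0 := by
    rw [cone_eq_add pres I i c, h1, h3, TensorProduct.tmul_zero, map_zero]
    exact add_zero 0
  rw [h5, Prod.mk_eq_zero]
  exact ⟨rfl, funext fun s => Subtype.ext (congrFun h4 s)⟩

theorem arrow_mem_range_kernelMap (b : Module.Basis ι k M) (hq : ∀ s, g (q s) = b s)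
    {d : GBPAlgebra pres I} (hd : d ∈ arrowIdeal pres I i) (p : P) :
    coneMk pres I i P (d ⊗ₜ p) ∈ LinearMap.range (kernelMap pres I g q) := by
  -- The component of `p` in `Ker g` for the `k`-splitting given by the lifts `q s`; the coordinates
  -- of `g p`, multiplied by `d`, give the component in the copies of the arrow ideal.
  let p₀ : LinearMap.ker g := ⟨p - ∑ s, b.repr (g p) s • q s, by
    have h : ∀ (c : k) (p : P), g (c • p) = c • g p := (g.restrictScalars k).map_smul
    rw [LinearMap.mem_ker, map_sub, map_sum]
    simp only [h, hq]
    rw [b.sum_repr, sub_self]⟩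
  refine ⟨(coneMk pres I i _ (d ⊗ₜ p₀), fun s => ⟨b.repr (g p) s • d, smul_mem_arrowIdeal hd _⟩), ?_⟩
  rw [kernelMap_apply, coneMap_mk, ← map_sum, ← map_add]
  congr 1
  simp only [TensorProduct.smul_tmul]
  rw [← TensorProduct.tmul_sum, ← TensorProduct.tmul_add]
  exact congrArg _ (sub_add_cancel _ _)

theorem exact_kernelMap (b : Module.Basis ι k M) (hq : ∀ s, g (q s) = b s) :
    Function.Exact (kernelMap pres I g q) (coneToTop pres I g) := by
  intro z
  constructor
  · intro hz
    -- After removal of its vertex part any element lies in the image; exactness thus concerns the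
    -- vertex part alone, which `hz` places in `Ker g`.
    have h : ∀ z : Cone pres I i P,
        z - coneMk pres I i P (ofVertex pres I i 1 ⊗ₜ coneFst pres I i z) ∈
        LinearMap.range (kernelMap pres I g q) := by
      intro z
      induction z using cone_induction with
      | vertex p => rw [coneFst_vertex, sub_self]; exact Submodule.zero_mem _
      | arrow d hd p =>
        rw [coneFst_arrow _ _ _ hd, TensorProduct.tmul_zero, map_zero, sub_zero]
        exact arrow_mem_range_kernelMap pres I g q b hq hd p
      | add y z hy hz =>
        rw [map_add, TensorProduct.tmul_add, map_add, add_sub_add_comm]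
        exact Submodule.add_mem _ hy hz
    have h' : coneMk pres I i P (ofVertex pres I i 1 ⊗ₜ coneFst pres I i z) ∈
        LinearMap.range (kernelMap pres I g q) := by
      refine ⟨(coneMk pres I i _ (ofVertex pres I i 1 ⊗ₜ ⟨coneFst pres I i z, hz⟩), 0), ?_⟩
      rw [kernelMap_apply, coneMap_mk]
      simp
    simpa using Submodule.add_mem _ (h z) h'
  · rintro ⟨⟨c, l⟩, rfl⟩
    rw [coneToTop_apply, coneFst_kernelMap]
    exact (coneFst pres I i c).2

end Exact

end GBP

end

/-! ### The main theorem. -/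

theorem mainTheorem8 {k : Type u} [Field k] [IsAlgClosed k]
    {V : Type v} [Quiver.{e} V] [Fintype V] [∀ i j : V, Finite (i ⟶ j)]
    (hacyclic : ∀ (i : V) (p : Quiver.Path i i), p = Quiver.Path.nil)
    {A : V → Type w} [∀ i, Ring (A i)] [∀ i, Algebra k (A i)] [∀ i, FiniteDimensional k (A i)]
    (hbasic : ∀ i, GBP.IsBasic k (A i))
    (pres : ∀ i, GBP.BoundQuiverPresentation k (A i))
    (I : Set (GBP.Relation k V)) (hI : GBP.IsAdmissible (GBP.relationIdeal I))
    (i : V)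
    {M : Type x} [AddCommGroup M] [Module k M] [Module (A i)ᵐᵒᵖ M] [IsScalarTower k (A i)ᵐᵒᵖ M]
    [Module.Finite (A i)ᵐᵒᵖ M]
    {P : Type y} [AddCommGroup P] [Module k P] [Module (A i)ᵐᵒᵖ P] [IsScalarTower k (A i)ᵐᵒᵖ P]
    [Module.Finite (A i)ᵐᵒᵖ P]
    (g : P →ₗ[(A i)ᵐᵒᵖ] M) (hg : GBP.IsProjectiveCover g) :
    ∃ (L : Type (max u v e w y)) (_ : AddCommGroup L)
      (_ : Module (GBP.GBPAlgebra pres I)ᵐᵒᵖ L)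
      (f : (GBP.Cone pres I i (LinearMap.ker g) × L) →ₗ[(GBP.GBPAlgebra pres I)ᵐᵒᵖ]
        GBP.Cone pres I i P)
      (h : GBP.Cone pres I i P →ₗ[(GBP.GBPAlgebra pres I)ᵐᵒᵖ] GBP.NaturalInclusion pres I i M),
      Module.Finite (GBP.GBPAlgebra pres I)ᵐᵒᵖ L ∧
      Function.Injective f ∧ Function.Exact f h ∧ Function.Surjective h ∧
      GBP.support pres I L ⊆ {j | j ≠ i ∧ Nonempty (Quiver.Path i j)} ∧
      (∀ j, Module.Free (A j)ᵐᵒᵖ (GBP.component pres I L j)) ∧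
      ((∀ ρ ∈ I, ρ.source ≠ i) → Module.Projective (GBP.GBPAlgebra pres I)ᵐᵒᵖ L) := by
  classical
  have : Module.Finite k M := Module.Finite.trans (A i)ᵐᵒᵖ M
  -- The lift of the index type puts `L` in the universe required by the statement.
  let b : Module.Basis (ULift.{y} (Fin (Module.finrank k M))) k M :=
    (Module.finBasis k M).reindex Equiv.ulift.symm
  -- The lifts only define a `k`-linear section of `g`; this suffices because `D ⊗ P` does not
  -- involve the `A i`-action on `P`.
  choose q hq using fun s => hg.surjective (b s)
  refine ⟨ULift.{y} (Fin (Module.finrank k M)) → GBP.arrowIdeal pres I i, inferInstance,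
    inferInstance, GBP.kernelMap pres I g q, GBP.coneToTop pres I g, inferInstance,
    GBP.kernelMap_injective pres I g q b hq, GBP.exact_kernelMap pres I g q b hq,
    GBP.coneToTop_surjective pres I g hg.surjective,
    fun j hj => GBP.mem_support_pi hacyclic hj,
    fun j => GBP.free_component_pi (GBP.free_component_arrowIdeal i j), fun hi => ?_⟩
  have := GBP.projective_arrowIdeal (pres := pres) hi
  exact .of_equiv (DFinsupp.linearEquivFunOnFintype (R := (GBP.GBPAlgebra pres I)ᵐᵒᵖ)
    (M := fun _ : ULift.{y} (Fin (Module.finrank k M)) => GBP.arrowIdeal pres I i))
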